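/- **Theorem (Unified policy iteration).** *Setting.* Consider a stationary POMDP with state space $\mathcal S\subset\mathbb R^{D_{\mathcal S}}$, observation space $\mathcal O\subset\mathbb R^{D_{\mathcal O}}$, action space $\mathcal A\subset\mathbb R^{D_{\mathcal A}}$, reward space $\mathcal R\subset\mathbb R$, all compact, and with transition function $\Omega:\mathcal S\times\mathcal A\to\Delta(\mathcal S)$, observation function $\Theta:\mathcal S\to\Delta(\mathcal O)$ and reward function $U:\mathcal S\times\mathcal A\to\Delta(\mathcal R)$ that are Lipschitz continuous (for the Wasserstein-1 distance). Densities are taken with respect to finite reference measures $ds$ on $\mathcal S$ and $da\neq0$ on $\mathcal A$ (Lebesgue measure in the continuous case, counting measure in the finite case). Let $\mathcal B=\Delta(\mathcal S)$ be the space of belief states. The agent has a probabilistic model consisting of a transition density $P(s'|b,a)$, a likelihood kernel $P(o'|s',b)$, a belief forward kernel $P(b'|s',o',b,a)$ (e.g. a Dirac mass at a deterministic belief update), a reward kernel $P(r|b,a)$ on $\mathcal R$, and a variational posterior density $q(s'|o',b)$, all measurable; put $P(s',o',b'|b,a)=P(s'|b,a)P(o'|s',b)P(b'|s',o',b,a)$.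 Assume that, for all $(b,a)$, $q(s'|o',b)>0$ for $P(\cdot|b,a)$-almost every $(s',o')$, and $\sup_{b,a}\mathbb E_{P(s',o'|b,a)}\big|\log\frac{P(s'|b,a)}{q(s'|o',b)}\big|<\infty$. A policy is a Markov kernel $\pi(da|b)$ from $\mathcal B$ to $\mathcal A$ with densities $\pi(a|b)$ such that $\log\pi(\cdot|b)$ is $\pi(\cdot|b)$-integrable for every $b$ and the entropy of $\pi(\cdot|b)$ is bounded in $b$. Fix $\alpha,\zeta\ge0$, $\beta>0$, $\gamma\in[0,1)$. For a policy $\pi$ let $$G^{(\pi)}(b)=\mathbb E\Big[\sum_{\tau\ge0}\gamma^{\tau}\Big(\beta\log\pi(a_\tau|b_\tau)-\alpha r_\tau+\zeta\log\tfrac{P(s_{\tau+1}|b_\tau,a_\tau)}{q(s_{\tau+1}|o_{\tau+1},b_\tau)}\Big)\Big],$$ where $b_0=b$, $a_\tau\sim\pi(\cdot|b_\tau)$, $r_\tau\sim P(\cdot|b_\tau,a_\tau)$ and $(s_{\tau+1},o_{\tau+1},b_{\tau+1})\sim P(\cdot|b_\tau,a_\tau)$, with $r_\tau$ and $(s_{\tau+1},o_{\tau+1},b_{\tau+1})$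 conditionally independent given $(b_\tau,a_\tau)$; let $$\mathcal G^{(\pi)}(b,a)=\mathbb E_{P(r|b,a)}\Big[-\alpha r+\mathbb E_{P(s',o',b'|b,a)}\big[\zeta\log\tfrac{P(s'|b,a)}{q(s'|o',b)}+\gamma G^{(\pi)}(b')\big]\Big],$$ and for $\mathcal G:\mathcal B\times\mathcal A\to\mathbb R$ let $$T^{unified}_{\pi}\mathcal G(b,a)=\mathbb E_{P(r|b,a)}\Big[-\alpha r+\mathbb E_{P(s',o',b'|b,a)}\big[\zeta\log\tfrac{P(s'|b,a)}{q(s'|o',b)}+\gamma\,\mathbb E_{\pi(a'|b')}[\beta\log\pi(a'|b')+\mathcal G(b',a')]\big]\Big].$$ Write $\sigma(-\mathcal G(b,\cdot)/\beta)$ for the probability measure proportional to $e^{-\mathcal G(b,a)/\beta}\,da$. *Iteration.* Let $\bar\Pi$ be a class of policies, $\bar\pi_0\in\bar\Pi$, and $\mathcal G_0:\mathcal B\times\mathcal A\to\mathbb R$ bounded and measurable. Let $\mathcal G_k$ and $\bar\pi_k\in\bar\Pi$ satisfy, for $k=0,1,2,\dots$ and every $b\in\mathcal B$, $$\mathcal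 G_{k+1}=T^{unified}_{\bar\pi_k}\mathcal G_k,\qquad \bar\pi_{k+1}(\cdot|b)\in\arg\min_{\bar\pi\in\bar\Pi}D_{KL}\big[\bar\pi(\cdot|b),\sigma(-\mathcal G_{k+1}(b,\cdot)/\beta)\big].$$ Call $\bar\pi^*\in\bar\Pi$ optimal if $G^{(\bar\pi^*)}(b)=\min_{\bar\pi\in\bar\Pi}G^{(\bar\pi)}(b)$ for every $b$. *Conclusion.* 1. For every $\varepsilon>0$, for all large $k$, $G^{(\bar\pi_k)}(b)\le G^{(\bar\pi)}(b)+\varepsilon$ for all $b\in\mathcal B$ and $\bar\pi\in\bar\Pi$. 2. If $\bar\pi^*$ is optimal, then $\mathcal G_k\to\mathcal G^{(\bar\pi^*)}$ uniformly on $\mathcal B\times\mathcal A$. 3. If $\bar\Pi$ is convex (closed under mixtures) and $\bar\pi^*$ is optimal, then it is the only optimal policy and $\bar\pi_k(\cdot|b)\to\bar\pi^*(\cdot|b)$ in total variation, uniformly in $b\in\mathcal B$. 4. If $\bar\Pi$ is convex and sequentially closed, among policies, under convergence in total variation uniform in $b$, then an optimal policy $\bar\pi^*\in\bar\Pi$ exists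 (so $\bar\pi_k\to\bar\pi^*$ and $\mathcal G_k\to\mathcal G^{(\bar\pi^*)}$ as above). -/

import Mathlib

open MeasureTheory ProbabilityTheory

/-- A stationary POMDP with state space `S`, observation space `O`, action space `A` (subsets of
Euclidean spaces) and reward space `R ⊆ ℝ`, initial distribution `d0`, transition function `Ω`,
reward function `U` and observation function `Θ`. The finite measures `refS` and `refA` are the
measures `ds` and `da` with respect to which densities on `S` and on `A` are taken: Lebesgue measure
on a (compact) continuous space, counting measure on a finite one. -/
structure POMDP (dS dO dA : ℕ) where
  S : Set (EuclideanSpace ℝ (Fin dS))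
  O : Set (EuclideanSpace ℝ (Fin dO))
  A : Set (EuclideanSpace ℝ (Fin dA))
  R : Set ℝ
  refS : Measure S
  refA : Measure A
  refS_finite : IsFiniteMeasure refS
  refA_finite : IsFiniteMeasure refA
  refA_ne_zero : refA ≠ 0
  d0 : ProbabilityMeasure S
  Ω : Kernel (S × A) S
  Ω_markov : IsMarkovKernel Ω
  U : Kernel (S × A) R
  U_markov : IsMarkovKernel U
  Θ : Kernel S O
  Θ_markov : IsMarkovKernel Θ

attribute [instance] POMDP.refS_finite POMDP.refA_finite POMDP.Ω_markov POMDP.U_markov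
  POMDP.Θ_markov

/-- A map `x ↦ κ x` into probability distributions is Lipschitz for the Kantorovich (Wasserstein-1)
distance, written in its dual form. -/
def LipschitzKernel {X Y : Type*} [PseudoMetricSpace X] [MeasurableSpace X] [PseudoMetricSpace Y]
    [MeasurableSpace Y] (κ : Kernel X Y) : Prop :=
  ∃ K : ℝ, ∀ f : Y → ℝ, LipschitzWith 1 f → ∀ x x' : X,
    |∫ y, f y ∂κ x - ∫ y, f y ∂κ x'| ≤ K * dist x x'

namespace POMDP

variable {dS dO dA : ℕ}

/-- POMDP regularity (A1)-(A5): compact spaces, Lipschitz transition, observation and reward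
functions. -/
structure Regular (M : POMDP dS dO dA) : Prop where
  compact_S : IsCompact M.S
  compact_A : IsCompact M.A
  compact_O : IsCompact M.O
  compact_R : IsCompact M.R
  lipschitz_Ω : LipschitzKernel M.Ω
  lipschitz_Θ : LipschitzKernel M.Θ
  lipschitz_U : LipschitzKernel M.U

/-- The belief space: all probability distributions over the states. -/
abbrev Belief (M : POMDP dS dO dA) : Type := ProbabilityMeasure M.S

/-- The agent's (learned) belief-state-conditioned probabilistic model of the POMDP:
* `trans b a s'` is the density `P(s'|b,a)` of the transition model;
* `lik (s',b)` is the likelihood model `P(o'|s',b)`;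
* `upd (s',o',b,a)` is the belief state forward distribution `P(b'|s',o',b,a)`
  (a Dirac mass when beliefs are updated by a deterministic rule such as Bayes' rule);
* `rew (b,a)` is the reward model `P(r|b,a)`;
* `q o' b s'` is the density `q(s'|o',b)` of the variational posterior. -/
structure AgentModel (M : POMDP dS dO dA) where
  trans : M.Belief → M.A → M.S → ℝ
  trans_measurable : Measurable fun x : (M.Belief × M.A) × M.S => trans x.1.1 x.1.2 x.2
  trans_nonneg : ∀ b a s, 0 ≤ trans b a s
  trans_lintegral : ∀ b a, ∫⁻ s, ENNReal.ofReal (trans b a s) ∂M.refS = 1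
  lik : Kernel (M.S × M.Belief) M.O
  lik_markov : IsMarkovKernel lik
  upd : Kernel (M.S × M.O × M.Belief × M.A) M.Belief
  upd_markov : IsMarkovKernel upd
  rew : Kernel (M.Belief × M.A) M.R
  rew_markov : IsMarkovKernel rew
  q : M.O → M.Belief → M.S → ℝ
  q_measurable : Measurable fun x : M.O × M.Belief × M.S => q x.1 x.2.1 x.2.2
  q_nonneg : ∀ o b s, 0 ≤ q o b s
  q_lintegral : ∀ o b, ∫⁻ s, ENNReal.ofReal (q o b s) ∂M.refS = 1

attribute [instance] AgentModel.lik_markov AgentModel.upd_markov AgentModel.rew_markov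

namespace AgentModel

variable {M : POMDP dS dO dA}

/-- The transition model `P(s'|b,a) ds'` as a kernel. -/
noncomputable def transKernel (P : M.AgentModel) : Kernel (M.Belief × M.A) M.S :=
  Kernel.withDensity (Kernel.const _ M.refS) fun x s => ENNReal.ofReal (P.trans x.1 x.2 s)

instance (P : M.AgentModel) : IsMarkovKernel P.transKernel := by
  refine ⟨fun x => ⟨?_⟩⟩
  have h : Measurable (Function.uncurry fun (x : M.Belief × M.A) s =>
      ENNReal.ofReal (P.trans x.1 x.2 s)) := P.trans_measurable.ennreal_ofReal
  rw [transKernel, Kernel.withDensity_apply' _ h]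
  simpa using P.trans_lintegral x.1 x.2

/-- The joint law `P(s',o'|b,a) = P(s'|b,a) P(o'|s',b)`. -/
noncomputable def stateObs (P : M.AgentModel) : Kernel (M.Belief × M.A) (M.S × M.O) :=
  P.transKernel ⊗ₖ (P.lik.comap (fun x : (M.Belief × M.A) × M.S => (x.2, x.1.1)) (by fun_prop))

instance (P : M.AgentModel) : IsMarkovKernel P.stateObs := by
  unfold stateObs; infer_instance

/-- The belief state generative model
`P(s',o',b'|b,a) = P(s'|b,a) P(o'|s',b) P(b'|s',o',b,a)`, as a law of `((s',o'),b')`. -/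
noncomputable def next (P : M.AgentModel) :
    Kernel (M.Belief × M.A) ((M.S × M.O) × M.Belief) :=
  P.stateObs ⊗ₖ (P.upd.comap
    (fun x : (M.Belief × M.A) × (M.S × M.O) => (x.2.1, x.2.2, x.1.1, x.1.2)) (by fun_prop))

instance (P : M.AgentModel) : IsMarkovKernel P.next := by
  unfold next; infer_instance

/-- `log (P(s'|b,a) / q(s'|o',b))`. -/
noncomputable def logRatio (P : M.AgentModel) (b : M.Belief) (a : M.A) (y : M.S × M.O) : ℝ :=
  Real.log (P.trans b a y.1 / P.q y.2 b y.1)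

/-- The information-gain term is well defined and bounded: the variational posterior density does
not vanish where the model puts mass, and the log-ratio has a finite first absolute moment, bounded
uniformly in `(b,a)`. -/
def BoundedInfoGain (P : M.AgentModel) : Prop :=
  (∀ b a, ∀ᵐ y ∂P.stateObs (b, a), 0 < P.q y.2 b y.1) ∧
  ∃ C : ℝ, ∀ b a, Integrable (P.logRatio b a) (P.stateObs (b, a)) ∧
    ∫ y, |P.logRatio b a y| ∂P.stateObs (b, a) ≤ C

end AgentModel

/-- A (stationary, Markovian) stochastic belief state-action policy: a Markov kernel `π(da|b)` with
densities `π(a|b)` and a finite entropy that is bounded in `b`. -/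
structure Policy (M : POMDP dS dO dA) where
  ker : Kernel M.Belief M.A
  markov : IsMarkovKernel ker
  ac : ∀ b, ker b ≪ M.refA
  entropy_bounded : ∃ C : ℝ, ∀ b,
    Integrable (fun a => Real.log (Kernel.rnDeriv ker (Kernel.const _ M.refA) b a).toReal) (ker b) ∧
    |∫ a, Real.log (Kernel.rnDeriv ker (Kernel.const _ M.refA) b a).toReal ∂ker b| ≤ C

attribute [instance] Policy.markov

variable {M : POMDP dS dO dA}

/-- The density `π(a|b)` with respect to `da`. -/
noncomputable def Policy.density (π : M.Policy) (b : M.Belief) (a : M.A) : ℝ :=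
  (Kernel.rnDeriv π.ker (Kernel.const _ M.refA) b a).toReal

/-- Scaling factors `α, β, ζ` and discount factor `γ`. -/
structure Weights where
  α : ℝ
  β : ℝ
  ζ : ℝ
  γ : ℝ

/-- Admissible weights. -/
structure Weights.Valid (w : Weights) : Prop where
  α_nonneg : 0 ≤ w.α
  β_pos : 0 < w.β
  ζ_nonneg : 0 ≤ w.ζ
  γ_nonneg : 0 ≤ w.γ
  γ_lt_one : w.γ < 1

/-- One time step `((b_τ, a_τ), (r_τ, ((s_{τ+1}, o_{τ+1}), b_{τ+1})))`. -/
abbrev Step (M : POMDP dS dO dA) : Type :=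
  (M.Belief × M.A) × (M.R × ((M.S × M.O) × M.Belief))

/-- The law of a time step started at the belief `b_τ = b`:
`π(a|b) P(r|b,a) P(s',o',b'|b,a)`. -/
noncomputable def stepLaw (P : M.AgentModel) (π : M.Policy) : Kernel M.Belief M.Step :=
  (Kernel.id ×ₖ π.ker) ⊗ₖ Kernel.prodMkLeft M.Belief (P.rew ×ₖ P.next)

instance (P : M.AgentModel) (π : M.Policy) : IsMarkovKernel (stepLaw P π) := by
  unfold stepLaw; infer_instance

/-- Given the history up to time `n`, the next time step starts from the last updated belief. -/
noncomputable def stepKernel (P : M.AgentModel) (π : M.Policy) (n : ℕ) :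
    Kernel (Π _ : Finset.Iic n, M.Step) M.Step :=
  (stepLaw P π).comap (fun h => (h ⟨n, Finset.mem_Iic.2 le_rfl⟩).2.2.2) (by fun_prop)

instance (P : M.AgentModel) (π : M.Policy) (n : ℕ) : IsMarkovKernel (stepKernel P π n) := by
  unfold stepKernel; infer_instance

/-- The law of the infinite trajectory started at the belief `b` and following `π`:
`∏_τ π(a_τ|b_τ) P(s_{τ+1},o_{τ+1},b_{τ+1}|b_τ,a_τ) P(r_τ|b_τ,a_τ)`. -/
noncomputable def trajLaw (P : M.AgentModel) (π : M.Policy) (b : M.Belief) :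
    Measure (ℕ → M.Step) :=
  Kernel.trajMeasure (X := fun _ => M.Step) (stepLaw P π b) (stepKernel P π)

/-- `β log π(a_τ|b_τ) - α r_τ + ζ log (P(s_{τ+1}|b_τ,a_τ) / q(s_{τ+1}|o_{τ+1},b_τ))`. -/
noncomputable def stepCost (P : M.AgentModel) (w : Weights) (π : M.Policy) (x : M.Step) : ℝ :=
  w.β * Real.log (π.density x.1.1 x.1.2) - w.α * (x.2.1 : ℝ)
    + w.ζ * P.logRatio x.1.1 x.1.2 x.2.2.1

/-- The belief state EFE `G^{(π)}(b)`. -/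
noncomputable def efe (P : M.AgentModel) (w : Weights) (π : M.Policy) (b : M.Belief) : ℝ :=
  ∫ x, ∑' n : ℕ, w.γ ^ n * stepCost P w π (x n) ∂trajLaw P π b

/-- The belief state-action EFE `𝒢^{(π)}(b,a)`. -/
noncomputable def actionEfe (P : M.AgentModel) (w : Weights) (π : M.Policy) (b : M.Belief)
    (a : M.A) : ℝ :=
  ∫ r, (-(w.α * (r : ℝ)) + ∫ y, (w.ζ * P.logRatio b a y.1 + w.γ * efe P w π y.2)
    ∂P.next (b, a)) ∂P.rew (b, a)

/-- The unified Bellman operator `T^{unified}_π`. -/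
noncomputable def bellman (P : M.AgentModel) (w : Weights) (π : M.Policy)
    (g : M.Belief → M.A → ℝ) (b : M.Belief) (a : M.A) : ℝ :=
  ∫ r, (-(w.α * (r : ℝ)) + ∫ y, (w.ζ * P.logRatio b a y.1
      + w.γ * ∫ a', (w.β * Real.log (π.density y.2 a') + g y.2 a') ∂π.ker y.2)
    ∂P.next (b, a)) ∂P.rew (b, a)

/-- The Boltzmann distribution `σ(-g(b,·)/β)`, i.e. `exp(-g(b,a)/β) da / ∫ exp(-g(b,a')/β) da'`. -/
noncomputable def softmax (w : Weights) (g : M.Belief → M.A → ℝ) (b : M.Belief) : Measure M.A :=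
  M.refA.tilted fun a => -g b a / w.β

/-- `π` is a KL (information) projection of `σ(-g/β)` onto the class `Pi`, at every belief. -/
def IsInfoProjection (w : Weights) (Pi : Set M.Policy) (g : M.Belief → M.A → ℝ)
    (π : M.Policy) : Prop :=
  π ∈ Pi ∧ ∀ b, ∀ π' ∈ Pi,
    InformationTheory.klDiv (π.ker b) (softmax w g b) ≤
      InformationTheory.klDiv (π'.ker b) (softmax w g b)

/-- `π` is an optimal constrained policy: it minimizes `G^{(·)}(b)` over `Pi`, at every belief. -/
def IsOptimal (P : M.AgentModel) (w : Weights) (Pi : Set M.Policy) (π : M.Policy) : Prop :=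
  π ∈ Pi ∧ ∀ b, ∀ π' ∈ Pi, efe P w π b ≤ efe P w π' b

/-- The class contains the mixtures of its members. -/
def ConvexClass (Pi : Set M.Policy) : Prop :=
  ∀ π₁ ∈ Pi, ∀ π₂ ∈ Pi, ∀ t : ℝ, 0 ≤ t → t ≤ 1 → ∀ π : M.Policy,
    (∀ b, π.ker b = ENNReal.ofReal t • π₁.ker b + ENNReal.ofReal (1 - t) • π₂.ker b) → π ∈ Pi

/-- Convergence of policies in total variation, uniformly over the beliefs. -/
def TendstoTV (π : ℕ → M.Policy) (π' : M.Policy) : Prop :=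
  ∀ ε > 0, ∃ N, ∀ k ≥ N, ∀ b, ∀ E : Set M.A, MeasurableSet E →
    |((π k).ker b).real E - (π'.ker b).real E| ≤ ε

/-- The class is sequentially closed among policies under uniform total-variation convergence. -/
def ClosedClass (Pi : Set M.Policy) : Prop :=
  ∀ (π : ℕ → M.Policy) (π' : M.Policy), (∀ k, π k ∈ Pi) → TendstoTV π π' → π' ∈ Pi

end POMDP

/-!
Policy iteration is a perturbed fixed point iteration for a Bellman *optimality* operator, and its
convergence rests on contraction, comparison and strict convexity.

Write `value w π g b = E_{π(a|b)}[β log π(a|b) + g(b,a)]` for the free energy of `π` at `b`, and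
`backup P w F` for the one-step lookahead with continuation value `F`. By definition
`T_π g = backup (value w π g)` and `𝒢^{(π)} = backup (G^{(π)})`. Averaging the discounted sum of
costs over the first step of the trajectory gives the Bellman equation `G^{(π)} = value w π 𝒢^{(π)}`
(`efe_eq_value_actionEfe`); the series may be integrated term by term because the expected absolute
cost of a step is bounded uniformly in the belief. Hence `𝒢^{(π)}` is a fixed point of `T_π`, which
is monotone and contracts by `γ`.

The divergence of `π(·|b)` from the Boltzmann distribution `σ(-g(b,·)/β)` is `value w π g b / β` plus
a term that does not depend on `π` (`toReal_klDiv_softmax`). The information projection therefore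
minimizes the free energy at every belief, and from the first step on
`G (k + 1) = min_{π' ∈ Pi} T_{π'} (G k)`. A pointwise minimum of monotone contractions contracts as
well, so the iterates converge geometrically to some `H`. Passing to the limit, `H ≤ T_{π'} H` for
all `π'` in the class, while `T_{π k} H ≤ H + o(1)`. Comparing sub- and supersolutions
(`le_add_of_le_bellman_of_bellman_le`) gives `H ≤ 𝒢^{(π')}` and `𝒢^{(π k)} ≤ H + o(1)`, uniformly;
these estimates are collected in `IsIterationLimit`. The minimizing property of `π k` turns them
into asymptotic optimality, and if there is an optimal policy then `H` is its action value.

If the class is convex, two near-minimizers of `value w · H b` have densities that are close in `L¹`,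
with a modulus that does not depend on `b`: the midpoint gap of `x log x` controls `|x - y|`
(`mul_log_midpoint_gap`), and their mixture cannot be better than the infimum
(`integral_abs_density_sub_le`). As the iterates and any optimal policy are near-minimizers, this
yields uniform convergence in total variation, and so uniqueness. It also shows that the densities of
the iterates are uniformly Cauchy in `L¹`. Their limit has bounded entropy and minimizes the free
energy for `H` by Fatou's lemma, it belongs to the class if the class is closed, and a minimizer for
`H` is optimal (`IsIterationLimit.isOptimal_of_value_le`).
-/

namespace POMDP

variable {dS dO dA : ℕ} {M : POMDP dS dO dA}

/-! ### Densities of policies -/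

/-- `x log x ≥ -1`: the integrand of the negative entropy is bounded below. -/
lemma neg_one_le_mul_log {x : ℝ} (hx : 0 ≤ x) : -1 ≤ x * Real.log x := by
  rcases hx.eq_or_lt with rfl | hx
  · simp
  · have h := mul_le_mul_of_nonneg_left (Real.one_sub_inv_le_log_of_pos hx) hx.le
    rw [mul_sub, mul_inv_cancel₀ hx.ne'] at h
    linarith

namespace Policy

@[ext]
lemma ext {π π' : M.Policy} (h : ∀ b, π.ker b = π'.ker b) : π = π' := by
  obtain ⟨κ, _, _, _⟩ := π
  obtain ⟨κ', _, _, _⟩ := π'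
  obtain rfl : κ = κ' := Kernel.ext h
  rfl

variable (π : M.Policy)

lemma measurable_density : Measurable fun x : M.Belief × M.A => π.density x.1 x.2 :=
  (Kernel.measurable_rnDeriv π.ker (Kernel.const _ M.refA)).ennreal_toReal

lemma measurable_density_right (b : M.Belief) : Measurable (π.density b) :=
  π.measurable_density.comp measurable_prodMk_left

lemma density_nonneg (b : M.Belief) (a : M.A) : 0 ≤ π.density b a := ENNReal.toReal_nonneg

lemma density_ae_eq_rnDeriv (b : M.Belief) :
    π.density b =ᵐ[M.refA] fun a => ((π.ker b).rnDeriv M.refA a).toReal := by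
  have h := Kernel.rnDeriv_eq_rnDeriv_measure (κ := π.ker) (η := Kernel.const _ M.refA) (a := b)
  rw [Kernel.const_apply] at h
  filter_upwards [h] with a ha
  rw [density, ha]

lemma ker_eq_withDensity (b : M.Belief) :
    π.ker b = M.refA.withDensity fun a => ENNReal.ofReal (π.density b a) := by
  conv_lhs => rw [← Measure.withDensity_rnDeriv_eq _ _ (π.ac b)]
  refine withDensity_congr_ae ?_
  filter_upwards [π.density_ae_eq_rnDeriv b, Measure.rnDeriv_lt_top (π.ker b) M.refA] with a ha ha'
  rw [ha, ENNReal.ofReal_toReal ha'.ne]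

lemma integral_ker (b : M.Belief) (f : M.A → ℝ) :
    ∫ a, f a ∂π.ker b = ∫ a, π.density b a * f a ∂M.refA := by
  rw [ker_eq_withDensity, integral_withDensity_eq_integral_toReal_smul
    (π.measurable_density_right b).ennreal_ofReal (by simp)]
  simp [ENNReal.toReal_ofReal (π.density_nonneg b _)]

lemma integrable_ker_iff (b : M.Belief) (f : M.A → ℝ) :
    Integrable f (π.ker b) ↔ Integrable (fun a => π.density b a * f a) M.refA := by
  rw [ker_eq_withDensity, integrable_withDensity_iff_integrable_smul'
    (π.measurable_density_right b).ennreal_ofReal (by simp)]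
  simp [ENNReal.toReal_ofReal (π.density_nonneg b _)]

lemma integrable_density (b : M.Belief) : Integrable (π.density b) M.refA := by
  simpa using (π.integrable_ker_iff b fun _ => 1).1 (integrable_const _)

lemma integral_density (b : M.Belief) : ∫ a, π.density b a ∂M.refA = 1 := by
  simpa using (π.integral_ker b fun _ => 1).symm

lemma integrable_log_density (b : M.Belief) :
    Integrable (fun a => Real.log (π.density b a)) (π.ker b) :=
  (π.entropy_bounded.choose_spec b).1

lemma integrable_density_mul_log (b : M.Belief) :
    Integrable (fun a => π.density b a * Real.log (π.density b a)) M.refA :=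
  (π.integrable_ker_iff b _).1 (π.integrable_log_density b)

/-- The log-density is bounded in `L¹(π(·|b))`, uniformly in `b`: its positive part is controlled
by the entropy, its negative part by `x log x ≥ -1` and the finiteness of the reference measure. -/
lemma exists_integral_abs_log_density_le :
    ∃ C : ℝ, ∀ b, ∫ a, |Real.log (π.density b a)| ∂π.ker b ≤ C := by
  obtain ⟨C, hC⟩ := π.entropy_bounded
  refine ⟨C + 2 * M.refA.real Set.univ, fun b => ?_⟩
  have h1 : ∫ a, Real.log (π.density b a) ∂π.ker b ≤ C := (abs_le.1 (hC b).2).2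
  rw [integral_ker] at h1 ⊢
  calc ∫ a, π.density b a * |Real.log (π.density b a)| ∂M.refA
      ≤ ∫ a, (π.density b a * Real.log (π.density b a) + 2) ∂M.refA := by
        refine integral_mono ?_ ((π.integrable_density_mul_log b).add (integrable_const _))
          fun a => ?_
        · exact (π.integrable_ker_iff b _).1 (π.integrable_log_density b).abs
        · have h0 := π.density_nonneg b a
          have h2 := neg_one_le_mul_log h0
          have h3 : π.density b a * |Real.log (π.density b a)|
              = |π.density b a * Real.log (π.density b a)| := by rw [abs_mul, abs_of_nonneg h0]
          simp only [h3]
          exact abs_le.2 ⟨by linarith, by linarith⟩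
    _ = ∫ a, π.density b a * Real.log (π.density b a) ∂M.refA + 2 * M.refA.real Set.univ := by
        rw [integral_add (π.integrable_density_mul_log b) (integrable_const _)]
        simp [mul_comm]
    _ ≤ _ := by linarith

end Policy

/-! ### Bounded measurable functions -/

/-- Bounded measurable real functions, the functions on which the Bellman operators act. -/
def BoundedMeasurable {X : Type*} [MeasurableSpace X] (f : X → ℝ) : Prop :=
  Measurable f ∧ ∃ C : ℝ, ∀ x, |f x| ≤ C

namespace BoundedMeasurable

variable {X Y : Type*} [MeasurableSpace X] [MeasurableSpace Y] {f g : X → ℝ}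

lemma add (hf : BoundedMeasurable f) (hg : BoundedMeasurable g) :
    BoundedMeasurable fun x => f x + g x := by
  obtain ⟨hf, C, hC⟩ := hf
  obtain ⟨hg, D, hD⟩ := hg
  exact ⟨hf.add hg, C + D, fun x => (abs_add_le _ _).trans (add_le_add (hC x) (hD x))⟩

lemma const_mul (c : ℝ) (hf : BoundedMeasurable f) : BoundedMeasurable fun x => c * f x := by
  obtain ⟨hf, C, hC⟩ := hf
  refine ⟨hf.const_mul c, |c| * C, fun x => ?_⟩
  rw [abs_mul]
  exact mul_le_mul_of_nonneg_left (hC x) (abs_nonneg c)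

lemma comp {u : Y → X} (hf : BoundedMeasurable f) (hu : Measurable u) :
    BoundedMeasurable fun y => f (u y) :=
  ⟨hf.1.comp hu, hf.2.imp fun _ h y => h (u y)⟩

lemma integrable (hf : BoundedMeasurable f) (μ : Measure X) [IsFiniteMeasure μ] :
    Integrable f μ := by
  obtain ⟨hf, C, hC⟩ := hf
  exact Integrable.of_bound hf.aestronglyMeasurable C (ae_of_all _ hC)

/-- Integrating against a Markov kernel an integrand whose absolute moments are bounded. -/
lemma integral_kernel_of_integral_abs_le (κ : Kernel X Y) [IsMarkovKernel κ] {h : X → Y → ℝ}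
    (hh : Measurable fun z : X × Y => h z.1 z.2) {C : ℝ} (hC : ∀ x, ∫ y, |h x y| ∂κ x ≤ C) :
    BoundedMeasurable fun x => ∫ y, h x y ∂κ x :=
  ⟨(hh.stronglyMeasurable.integral_kernel_prod_right (κ := κ)).measurable, C, fun x =>
    (abs_integral_le_integral_abs).trans (hC x)⟩

lemma integral_kernel (κ : Kernel X Y) [IsMarkovKernel κ] {h : X → Y → ℝ}
    (hh : BoundedMeasurable fun z : X × Y => h z.1 z.2) :
    BoundedMeasurable fun x => ∫ y, h x y ∂κ x := by
  obtain ⟨hm, C, hC⟩ := hh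
  refine integral_kernel_of_integral_abs_le κ hm (C := C) fun x => ?_
  have hi : Integrable (fun y => |h x y|) (κ x) :=
    Integrable.of_bound (hm.comp measurable_prodMk_left).abs.aestronglyMeasurable C
      (ae_of_all _ fun y => by simpa using hC (x, y))
  simpa using integral_mono hi (integrable_const C) fun y => hC (x, y)

end BoundedMeasurable

lemma boundedMeasurable_reward (hM : M.Regular) : BoundedMeasurable fun r : M.R => (r : ℝ) := by
  obtain ⟨C, hC⟩ := hM.compact_R.isBounded.exists_norm_le
  exact ⟨measurable_subtype_coe, C, fun r => hC r r.2⟩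

/-! ### One-step lookahead -/

/-- The free energy `E_{π(a|b)}[β log π(a|b) + g(b,a)]` of the policy `π` at the belief `b`. -/
noncomputable def value (w : Weights) (π : M.Policy) (g : M.Belief → M.A → ℝ) (b : M.Belief) : ℝ :=
  ∫ a, (w.β * Real.log (π.density b a) + g b a) ∂π.ker b

/-- One-step lookahead: the expected immediate cost of acting in `b`, apart from the policy's
log-density, plus the discounted expectation of `F` at the next belief. -/
noncomputable def backup (P : M.AgentModel) (w : Weights) (F : M.Belief → ℝ) (b : M.Belief)
    (a : M.A) : ℝ :=
  ∫ r, (-(w.α * (r : ℝ)) + ∫ y, (w.ζ * P.logRatio b a y.1 + w.γ * F y.2) ∂P.next (b, a))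
    ∂P.rew (b, a)

lemma bellman_eq_backup (P : M.AgentModel) (w : Weights) (π : M.Policy)
    (g : M.Belief → M.A → ℝ) : bellman P w π g = backup P w (value w π g) := rfl

lemma actionEfe_eq_backup (P : M.AgentModel) (w : Weights) (π : M.Policy) :
    actionEfe P w π = backup P w (efe P w π) := rfl

section Value

variable {w : Weights} {π : M.Policy} {g g' : M.Belief → M.A → ℝ} {b : M.Belief}

lemma BoundedMeasurable.integrable_ker
    (hg : BoundedMeasurable fun x : M.Belief × M.A => g x.1 x.2) (π : M.Policy) (b : M.Belief) :
    Integrable (g b) (π.ker b) :=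
  (hg.comp measurable_prodMk_left).integrable _

lemma value_eq (hg : BoundedMeasurable fun x : M.Belief × M.A => g x.1 x.2) :
    value w π g b
      = w.β * ∫ a, Real.log (π.density b a) ∂π.ker b + ∫ a, g b a ∂π.ker b := by
  rw [value, integral_add ((π.integrable_log_density b).const_mul _) (hg.integrable_ker π b),
    integral_const_mul]

lemma boundedMeasurable_log_density (π : M.Policy) :
    BoundedMeasurable fun b => ∫ a, Real.log (π.density b a) ∂π.ker b := by
  obtain ⟨C, hC⟩ := π.exists_integral_abs_log_density_le
  exact BoundedMeasurable.integral_kernel_of_integral_abs_le π.ker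
    (Real.measurable_log.comp π.measurable_density) hC

lemma boundedMeasurable_value (hg : BoundedMeasurable fun x : M.Belief × M.A => g x.1 x.2) :
    BoundedMeasurable (value w π g) := by
  simp only [funext fun b => value_eq (w := w) (π := π) (b := b) hg]
  exact ((boundedMeasurable_log_density π).const_mul _).add
    (BoundedMeasurable.integral_kernel π.ker hg)

lemma value_le_value_add (hg : BoundedMeasurable fun x : M.Belief × M.A => g x.1 x.2)
    (hg' : BoundedMeasurable fun x : M.Belief × M.A => g' x.1 x.2) {δ : ℝ}
    (h : ∀ a, g b a ≤ g' b a + δ) : value w π g b ≤ value w π g' b + δ := by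
  have h1 : ∫ a, g b a ∂π.ker b ≤ ∫ a, g' b a ∂π.ker b + δ := by
    simpa [integral_add (hg'.integrable_ker π b) (integrable_const δ)] using
      integral_mono (hg.integrable_ker π b)
        ((hg'.integrable_ker π b).add (integrable_const δ)) h
  rw [value_eq hg, value_eq hg']
  linarith

end Value

section Backup

variable {P : M.AgentModel} {w : Weights} {F F' : M.Belief → ℝ} {b : M.Belief} {a : M.A}

lemma measurable_logRatio (P : M.AgentModel) :
    Measurable fun x : (M.Belief × M.A) × (M.S × M.O) => P.logRatio x.1.1 x.1.2 x.2 := by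
  refine Real.measurable_log.comp (Measurable.div ?_ ?_)
  · exact P.trans_measurable.comp
      (f := fun x : (M.Belief × M.A) × (M.S × M.O) => (x.1, x.2.1)) (by fun_prop)
  · exact P.q_measurable.comp
      (f := fun x : (M.Belief × M.A) × (M.S × M.O) => (x.2.2, x.1.1, x.2.1)) (by fun_prop)

lemma map_fst_next (P : M.AgentModel) (x : M.Belief × M.A) :
    (P.next x).map Prod.fst = P.stateObs x := by
  rw [← Kernel.map_apply _ measurable_fst, ← Kernel.fst_eq, AgentModel.next,
    Kernel.fst_compProd]

lemma integrable_logRatio (hP : P.BoundedInfoGain) (b : M.Belief) (a : M.A) :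
    Integrable (fun y : (M.S × M.O) × M.Belief => P.logRatio b a y.1) (P.next (b, a)) := by
  have h := (hP.2.choose_spec b a).1
  rw [← map_fst_next] at h
  exact h.comp_measurable measurable_fst

lemma exists_integral_abs_logRatio_le (hP : P.BoundedInfoGain) :
    ∃ C : ℝ, ∀ x : M.Belief × M.A, ∫ y, |P.logRatio x.1 x.2 y.1| ∂P.next x ≤ C := by
  obtain ⟨C, hC⟩ := hP.2
  refine ⟨C, fun x => ?_⟩
  have h := (hC x.1 x.2).2
  rwa [Prod.mk.eta, ← map_fst_next, integral_map measurable_fst.aemeasurable] at h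
  exact ((measurable_logRatio P).comp measurable_prodMk_left).abs.aestronglyMeasurable

lemma backup_eq (hM : M.Regular) (hP : P.BoundedInfoGain) (hF : BoundedMeasurable F) :
    backup P w F b a = -(w.α * ∫ r, (r : ℝ) ∂P.rew (b, a))
      + w.ζ * ∫ y, P.logRatio b a y.1 ∂P.next (b, a) + w.γ * ∫ y, F y.2 ∂P.next (b, a) := by
  have hF' := ((hF.comp (Y := (M.S × M.O) × M.Belief) measurable_snd).integrable (P.next (b, a)))
  rw [backup, integral_add
    ((((boundedMeasurable_reward hM).integrable _).const_mul _).fun_neg) (integrable_const _),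
    integral_add ((integrable_logRatio hP b a).const_mul _) (hF'.const_mul _), integral_neg]
  simp only [integral_const_mul, integral_const, probReal_univ, one_smul]
  ring

lemma boundedMeasurable_backup (hM : M.Regular) (hP : P.BoundedInfoGain)
    (hF : BoundedMeasurable F) :
    BoundedMeasurable fun x : M.Belief × M.A => backup P w F x.1 x.2 := by
  simp only [backup_eq (w := w) hM hP hF]
  have h1 : BoundedMeasurable fun x : M.Belief × M.A => ∫ r, (r : ℝ) ∂P.rew x :=
    BoundedMeasurable.integral_kernel P.rew ((boundedMeasurable_reward hM).comp measurable_snd)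
  have h2 : BoundedMeasurable fun x : M.Belief × M.A =>
      ∫ y, P.logRatio x.1 x.2 y.1 ∂P.next x := by
    obtain ⟨C, hC⟩ := exists_integral_abs_logRatio_le hP
    exact BoundedMeasurable.integral_kernel_of_integral_abs_le P.next
      ((measurable_logRatio P).comp
        (f := fun z : (M.Belief × M.A) × ((M.S × M.O) × M.Belief) => (z.1, z.2.1))
        (by fun_prop)) hC
  have h3 : BoundedMeasurable fun x : M.Belief × M.A => ∫ y, F y.2 ∂P.next x :=
    BoundedMeasurable.integral_kernel P.next (hF.comp (measurable_snd.comp measurable_snd))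
  simpa [neg_mul] using ((h1.const_mul (-w.α)).add (h2.const_mul w.ζ)).add (h3.const_mul w.γ)

lemma backup_le_backup_add (hM : M.Regular) (hP : P.BoundedInfoGain) (hw : w.Valid)
    (hF : BoundedMeasurable F) (hF' : BoundedMeasurable F') {δ : ℝ} (h : ∀ b, F b ≤ F' b + δ) :
    backup P w F b a ≤ backup P w F' b a + w.γ * δ := by
  have hi := (hF.comp (Y := (M.S × M.O) × M.Belief) measurable_snd).integrable (P.next (b, a))
  have hi' := (hF'.comp (Y := (M.S × M.O) × M.Belief) measurable_snd).integrable (P.next (b, a))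
  have h1 : ∫ y, F y.2 ∂P.next (b, a) ≤ ∫ y, F' y.2 ∂P.next (b, a) + δ := by
    simpa [integral_add hi' (integrable_const δ)] using
      integral_mono hi (hi'.add (integrable_const δ)) fun y => h y.2
  rw [backup_eq hM hP hF, backup_eq hM hP hF']
  linarith [mul_le_mul_of_nonneg_left h1 hw.γ_nonneg]

end Backup

/-! ### The law of one time step -/

section StepLaw

variable {P : M.AgentModel} {w : Weights} {π : M.Policy} {F : M.Belief → ℝ}

lemma stepLaw_apply (P : M.AgentModel) (π : M.Policy) (b : M.Belief) :
    stepLaw P π b = ((π.ker b).map (Prod.mk b)) ⊗ₘ (P.rew ×ₖ P.next) := by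
  ext s hs
  rw [stepLaw, Kernel.compProd_apply hs, Measure.compProd_apply hs, Kernel.prod_apply,
    Kernel.id_apply, Measure.dirac_prod]
  simp

lemma map_fst_stepLaw (P : M.AgentModel) (π : M.Policy) (b : M.Belief) :
    (stepLaw P π b).map Prod.fst = (π.ker b).map (Prod.mk b) := by
  have := Measure.isProbabilityMeasure_map (μ := π.ker b)
    (measurable_prodMk_left (x := b)).aemeasurable
  rw [stepLaw_apply]
  exact Measure.fst_compProd _ _

/-- The contribution of reward, information gain and future cost to the cost of a step. -/
noncomputable def outcomeCost (P : M.AgentModel) (w : Weights) (F : M.Belief → ℝ) (x : M.Step) :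
    ℝ :=
  -(w.α * (x.2.1 : ℝ)) + w.ζ * P.logRatio x.1.1 x.1.2 x.2.2.1 + w.γ * F x.2.2.2

lemma measurable_outcomeCost (P : M.AgentModel) (w : Weights) (hF : Measurable F) :
    Measurable (outcomeCost P w F) := by
  have h := (measurable_logRatio P).comp (f := fun x : M.Step => (x.1, x.2.2.1)) (by fun_prop)
  have h' : Measurable fun x : M.Step => (x.2.1 : ℝ) := by fun_prop
  exact (((h'.const_mul _).neg).add (h.const_mul _)).add ((hF.comp (by fun_prop)).const_mul _)

lemma integrable_outcomeCost_outcome (hM : M.Regular) (hP : P.BoundedInfoGain)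
    (hF : BoundedMeasurable F) (x : M.Belief × M.A) :
    Integrable (fun z => outcomeCost P w F (x, z)) ((P.rew x).prod (P.next x)) := by
  have h1 := ((boundedMeasurable_reward hM).integrable (P.rew x)).comp_fst (P.next x)
  have h2 := (integrable_logRatio hP x.1 x.2).comp_snd (P.rew x)
  have h3 := ((hF.comp (Y := (M.S × M.O) × M.Belief) measurable_snd).integrable
    (P.next x)).comp_snd (P.rew x)
  exact (((h1.const_mul w.α).fun_neg).add (h2.const_mul w.ζ)).add (h3.const_mul w.γ)

lemma integral_outcomeCost_outcome (hM : M.Regular) (hP : P.BoundedInfoGain)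
    (hF : BoundedMeasurable F) (x : M.Belief × M.A) :
    ∫ z, outcomeCost P w F (x, z) ∂((P.rew x).prod (P.next x)) = backup P w F x.1 x.2 := by
  have h1 := ((boundedMeasurable_reward hM).integrable (P.rew x)).comp_fst (P.next x)
  have h2 := (integrable_logRatio hP x.1 x.2).comp_snd (P.rew x)
  have h3 := ((hF.comp (Y := (M.S × M.O) × M.Belief) measurable_snd).integrable
    (P.next x)).comp_snd (P.rew x)
  simp only [outcomeCost]
  rw [integral_add (((h1.const_mul w.α).fun_neg).fun_add (h2.const_mul w.ζ)) (h3.const_mul w.γ),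
    integral_add ((h1.const_mul w.α).fun_neg) (h2.const_mul w.ζ), integral_neg,
    integral_const_mul, integral_const_mul, integral_const_mul, backup_eq hM hP hF,
    integral_fun_fst (fun r : M.R => (r : ℝ)),
    integral_fun_snd (fun y : (M.S × M.O) × M.Belief => P.logRatio x.1 x.2 y.1),
    integral_fun_snd (fun y : (M.S × M.O) × M.Belief => F y.2)]
  simp

lemma exists_integral_abs_outcomeCost_le (hM : M.Regular) (hP : P.BoundedInfoGain)
    (hw : w.Valid) (hF : BoundedMeasurable F) :
    ∃ C : ℝ, ∀ x, ∫ z, |outcomeCost P w F (x, z)| ∂((P.rew x).prod (P.next x)) ≤ C := by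
  obtain ⟨C₁, hC₁⟩ := (boundedMeasurable_reward hM).2
  obtain ⟨C₂, hC₂⟩ := exists_integral_abs_logRatio_le hP
  obtain ⟨C₃, hC₃⟩ := hF.2
  refine ⟨w.α * C₁ + w.ζ * C₂ + w.γ * C₃, fun x => ?_⟩
  have hi := ((integrable_logRatio hP x.1 x.2).comp_snd (P.rew x)).abs
  calc ∫ z, |outcomeCost P w F (x, z)| ∂((P.rew x).prod (P.next x))
      ≤ ∫ z, (w.α * C₁ + w.γ * C₃ + w.ζ * |P.logRatio x.1 x.2 z.2.1|)
          ∂((P.rew x).prod (P.next x)) := by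
        refine integral_mono (integrable_outcomeCost_outcome hM hP hF x).abs
          ((integrable_const _).add (hi.const_mul _)) fun z => ?_
        refine (abs_add_three _ _ _).trans ?_
        rw [abs_neg, abs_mul, abs_mul, abs_mul, abs_of_nonneg hw.α_nonneg,
          abs_of_nonneg hw.ζ_nonneg, abs_of_nonneg hw.γ_nonneg]
        have h1 := mul_le_mul_of_nonneg_left (hC₁ z.1) hw.α_nonneg
        have h3 := mul_le_mul_of_nonneg_left (hC₃ z.2.2) hw.γ_nonneg
        simp only
        linarith
    _ = w.α * C₁ + w.γ * C₃ + w.ζ * ∫ y, |P.logRatio x.1 x.2 y.1| ∂P.next x := by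
        rw [integral_add (integrable_const _) (hi.const_mul _), integral_const_mul,
          integral_fun_snd (fun y : (M.S × M.O) × M.Belief => |P.logRatio x.1 x.2 y.1|)]
        simp
    _ ≤ _ := by linarith [mul_le_mul_of_nonneg_left (hC₂ x) hw.ζ_nonneg]

lemma integrable_outcomeCost (hM : M.Regular) (hP : P.BoundedInfoGain) (hw : w.Valid)
    (hF : BoundedMeasurable F) (b : M.Belief) :
    Integrable (outcomeCost P w F) (stepLaw P π b) := by
  have := Measure.isProbabilityMeasure_map (μ := π.ker b)
    (measurable_prodMk_left (x := b)).aemeasurable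
  obtain ⟨C, hC⟩ := exists_integral_abs_outcomeCost_le (w := w) hM hP hw hF
  have hm := measurable_outcomeCost P w hF.1
  rw [stepLaw_apply, Measure.integrable_compProd_iff hm.aestronglyMeasurable]
  simp only [Kernel.prod_apply, Real.norm_eq_abs]
  refine ⟨ae_of_all _ fun x => integrable_outcomeCost_outcome hM hP hF x, ?_⟩
  have h := BoundedMeasurable.integral_kernel_of_integral_abs_le (P.rew ×ₖ P.next) (C := C)
    (h := fun x z => |outcomeCost P w F (x, z)|) hm.abs
    (by simpa only [Kernel.prod_apply, abs_abs] using hC)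
  simp only [Kernel.prod_apply] at h
  exact h.integrable _

lemma integral_outcomeCost (hM : M.Regular) (hP : P.BoundedInfoGain) (hw : w.Valid)
    (hF : BoundedMeasurable F) (b : M.Belief) :
    ∫ x, outcomeCost P w F x ∂stepLaw P π b = ∫ a, backup P w F b a ∂π.ker b := by
  have := Measure.isProbabilityMeasure_map (μ := π.ker b)
    (measurable_prodMk_left (x := b)).aemeasurable
  have hi := integrable_outcomeCost (π := π) hM hP hw hF b
  rw [stepLaw_apply] at hi ⊢
  rw [Measure.integral_compProd hi]
  simp only [Kernel.prod_apply, integral_outcomeCost_outcome hM hP hF]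
  exact integral_map measurable_prodMk_left.aemeasurable
    (boundedMeasurable_backup hM hP hF).1.aestronglyMeasurable

lemma integrable_log_density_stepLaw (P : M.AgentModel) (π : M.Policy) (b : M.Belief) :
    Integrable (fun x : M.Step => Real.log (π.density x.1.1 x.1.2)) (stepLaw P π b) := by
  have hm : Measurable fun y : M.Belief × M.A => Real.log (π.density y.1 y.2) :=
    Real.measurable_log.comp π.measurable_density
  refine Integrable.comp_measurable (f := Prod.fst)
    (g := fun y : M.Belief × M.A => Real.log (π.density y.1 y.2)) ?_ measurable_fst
  rw [map_fst_stepLaw, integrable_map_measure hm.aestronglyMeasurable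
    measurable_prodMk_left.aemeasurable]
  exact π.integrable_log_density b

lemma integral_fst_stepLaw (P : M.AgentModel) (π : M.Policy) (b : M.Belief)
    {f : M.Belief × M.A → ℝ} (hf : Measurable f) :
    ∫ x, f x.1 ∂stepLaw P π b = ∫ a, f (b, a) ∂π.ker b := by
  rw [← integral_map (φ := Prod.fst) measurable_fst.aemeasurable hf.aestronglyMeasurable,
    map_fst_stepLaw, integral_map measurable_prodMk_left.aemeasurable hf.aestronglyMeasurable]

lemma stepCost_add_eq (P : M.AgentModel) (w : Weights) (π : M.Policy) (F : M.Belief → ℝ)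
    (x : M.Step) : stepCost P w π x + w.γ * F x.2.2.2
      = w.β * Real.log (π.density x.1.1 x.1.2) + outcomeCost P w F x := by
  rw [stepCost, outcomeCost]
  ring

lemma integrable_stepCost_add (hM : M.Regular) (hP : P.BoundedInfoGain) (hw : w.Valid)
    (hF : BoundedMeasurable F) (b : M.Belief) :
    Integrable (fun x => stepCost P w π x + w.γ * F x.2.2.2) (stepLaw P π b) := by
  simp only [stepCost_add_eq]
  exact ((integrable_log_density_stepLaw P π b).const_mul _).add
    (integrable_outcomeCost hM hP hw hF b)

lemma integral_stepCost_add (hM : M.Regular) (hP : P.BoundedInfoGain) (hw : w.Valid)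
    (hF : BoundedMeasurable F) (b : M.Belief) :
    ∫ x, (stepCost P w π x + w.γ * F x.2.2.2) ∂stepLaw P π b
      = value w π (backup P w F) b := by
  simp only [stepCost_add_eq]
  rw [integral_add ((integrable_log_density_stepLaw P π b).const_mul _)
    (integrable_outcomeCost hM hP hw hF b), integral_const_mul,
    integral_outcomeCost hM hP hw hF,
    integral_fst_stepLaw P π b (f := fun x => Real.log (π.density x.1 x.2))
      (Real.measurable_log.comp π.measurable_density),
    value_eq (boundedMeasurable_backup hM hP hF)]

lemma boundedMeasurable_zero : BoundedMeasurable fun _ : M.Belief => (0 : ℝ) :=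
  ⟨measurable_const, 0, by simp⟩

lemma measurable_stepCost (P : M.AgentModel) (w : Weights) (π : M.Policy) :
    Measurable (stepCost P w π) := by
  have h : stepCost P w π = fun x => w.β * Real.log (π.density x.1.1 x.1.2)
      + outcomeCost P w (fun _ => 0) x := by
    ext x
    simp [← stepCost_add_eq]
  rw [h]
  exact ((Real.measurable_log.comp (π.measurable_density.comp measurable_fst)).const_mul _).add
    (measurable_outcomeCost P w measurable_const)

lemma integrable_stepCost (hM : M.Regular) (hP : P.BoundedInfoGain) (hw : w.Valid)
    (b : M.Belief) : Integrable (stepCost P w π) (stepLaw P π b) := by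
  simpa using integrable_stepCost_add (π := π) hM hP hw boundedMeasurable_zero b

lemma exists_integral_abs_stepCost_le (hM : M.Regular) (hP : P.BoundedInfoGain) (hw : w.Valid)
    (π : M.Policy) : ∃ C : ℝ, ∀ b, ∫ x, |stepCost P w π x| ∂stepLaw P π b ≤ C := by
  obtain ⟨C₁, hC₁⟩ := π.exists_integral_abs_log_density_le
  obtain ⟨C₂, hC₂⟩ :=
    exists_integral_abs_outcomeCost_le (w := w) hM hP hw (boundedMeasurable_zero (M := M))
  refine ⟨w.β * C₁ + C₂, fun b => ?_⟩
  have := Measure.isProbabilityMeasure_map (μ := π.ker b)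
    (measurable_prodMk_left (x := b)).aemeasurable
  have hi := (integrable_log_density_stepLaw P π b).abs
  have hi' := (integrable_outcomeCost (π := π) hM hP hw boundedMeasurable_zero b).abs
  have h2 : ∫ x, |outcomeCost P w (fun _ => 0) x| ∂stepLaw P π b ≤ C₂ := by
    rw [stepLaw_apply] at hi' ⊢
    rw [Measure.integral_compProd hi']
    simp only [Kernel.prod_apply]
    have h := (Measure.integrable_compProd_iff hi'.aestronglyMeasurable).1 hi'
    have h3 : Integrable (fun x => ∫ z, |outcomeCost P w (fun _ => 0) (x, z)|
        ∂((P.rew x).prod (P.next x))) ((π.ker b).map (Prod.mk b)) := by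
      simpa [Kernel.prod_apply] using h.2
    simpa using integral_mono h3 (integrable_const C₂) hC₂
  calc ∫ x, |stepCost P w π x| ∂stepLaw P π b
      ≤ ∫ x, (w.β * |Real.log (π.density x.1.1 x.1.2)| + |outcomeCost P w (fun _ => 0) x|)
          ∂stepLaw P π b := by
        refine integral_mono (integrable_stepCost hM hP hw b).abs
          ((hi.const_mul _).add hi') fun x => ?_
        have h := stepCost_add_eq P w π (fun _ => 0) x
        rw [mul_zero, add_zero] at h
        simp only [h]
        refine (abs_add_le _ _).trans ?_
        rw [abs_mul, abs_of_pos hw.β_pos]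
    _ = w.β * ∫ a, |Real.log (π.density b a)| ∂π.ker b
          + ∫ x, |outcomeCost P w (fun _ => 0) x| ∂stepLaw P π b := by
        rw [integral_add (hi.const_mul _) hi', integral_const_mul,
          integral_fst_stepLaw P π b (f := fun x => |Real.log (π.density x.1 x.2)|)
            (Real.measurable_log.comp π.measurable_density).abs]
    _ ≤ _ := add_le_add (mul_le_mul_of_nonneg_left (hC₁ b) hw.β_pos.le) h2

end StepLaw

/-! ### Trajectories and the recursion for the expected free energy -/

section Trajectory

variable {P : M.AgentModel} {w : Weights} {π : M.Policy}

instance (P : M.AgentModel) (π : M.Policy) (b : M.Belief) :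
    IsProbabilityMeasure (trajLaw P π b) := by
  unfold trajLaw; infer_instance

/-- The transition kernel of the belief process under the policy `π`. -/
noncomputable def beliefKernel (P : M.AgentModel) (π : M.Policy) : Kernel M.Belief M.Belief :=
  (stepLaw P π).map fun x => x.2.2.2

instance (P : M.AgentModel) (π : M.Policy) : IsMarkovKernel (beliefKernel P π) := by
  unfold beliefKernel
  exact Kernel.IsMarkovKernel.map _ (by fun_prop)

/-- The law of the belief `b_n` when `b_0 = b`. -/
noncomputable def beliefLaw (P : M.AgentModel) (π : M.Policy) (b : M.Belief) :
    ℕ → Measure M.Belief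
  | 0 => Measure.dirac b
  | n + 1 => beliefKernel P π ∘ₘ beliefLaw P π b n

instance (P : M.AgentModel) (π : M.Policy) (b : M.Belief) (n : ℕ) :
    IsProbabilityMeasure (beliefLaw P π b n) := by
  induction n with
  | zero => unfold beliefLaw; infer_instance
  | succ n _ => unfold beliefLaw; infer_instance

lemma map_eval_zero_trajLaw (P : M.AgentModel) (π : M.Policy) (b : M.Belief) :
    (trajLaw P π b).map (fun x => x 0) = stepLaw P π b := by
  have h : (fun x : ℕ → M.Step => x 0)
      = (fun h : (Π _ : Finset.Iic 0, M.Step) => h ⟨0, Finset.mem_Iic.2 le_rfl⟩)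
        ∘ (Preorder.frestrictLe (π := fun _ : ℕ => M.Step) 0) := rfl
  rw [h, ← Measure.map_map (by fun_prop) (by fun_prop), trajLaw, Kernel.trajMeasure,
    Measure.map_comp _ _ (by fun_prop), Kernel.traj_map_frestrictLe, Kernel.partialTraj_self,
    Measure.id_comp, Measure.map_map (by fun_prop) (by fun_prop)]
  exact Measure.map_id

lemma map_eval_succ_trajLaw (P : M.AgentModel) (π : M.Policy) (b : M.Belief) (n : ℕ) :
    (trajLaw P π b).map (fun x => x (n + 1))
      = stepLaw P π ∘ₘ ((trajLaw P π b).map fun x => x n).map fun x => x.2.2.2 := by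
  have h := Kernel.map_frestrictLe_trajMeasure_compProd_eq_map_trajMeasure
    (X := fun _ => M.Step) (μ₀ := stepLaw P π b) (κ := stepKernel P π) (a := n)
  have h1 : (fun x : ℕ → M.Step => x (n + 1)) = Prod.snd ∘
      (fun x : ℕ → M.Step => (Preorder.frestrictLe (π := fun _ : ℕ => M.Step) n x, x (n + 1))) :=
    rfl
  rw [h1, ← Measure.map_map (by fun_prop) (by fun_prop), trajLaw, ← h]
  refine (Measure.snd_compProd _ _).trans ?_
  have hg : Measurable fun h : (Π _ : Finset.Iic n, M.Step) =>
      (h ⟨n, Finset.mem_Iic.2 le_rfl⟩).2.2.2 := by fun_prop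
  rw [stepKernel, ← Kernel.comp_deterministic_eq_comap _ hg, ← Measure.comp_assoc,
    Measure.deterministic_comp_eq_map hg, Measure.map_map hg (by fun_prop),
    Measure.map_map (by fun_prop) (by fun_prop)]
  rfl

/-- The `n`-th step of the trajectory is a step started at the random belief `b_n`. -/
lemma map_eval_trajLaw (P : M.AgentModel) (π : M.Policy) (b : M.Belief) (n : ℕ) :
    (trajLaw P π b).map (fun x => x n) = stepLaw P π ∘ₘ beliefLaw P π b n := by
  induction n with
  | zero => rw [map_eval_zero_trajLaw, beliefLaw, Measure.dirac_bind (Kernel.measurable _)]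
  | succ n ih =>
    rw [map_eval_succ_trajLaw, ih, Measure.map_comp _ _ (by fun_prop), beliefLaw, beliefKernel]

/-- The Markov operator of the belief process. -/
noncomputable def beliefOp (P : M.AgentModel) (π : M.Policy) (F : M.Belief → ℝ) (b : M.Belief) :
    ℝ :=
  ∫ b', F b' ∂beliefKernel P π b

lemma BoundedMeasurable.beliefOp {F : M.Belief → ℝ} (hF : BoundedMeasurable F) :
    BoundedMeasurable (beliefOp P π F) :=
  BoundedMeasurable.integral_kernel _ (hF.comp measurable_snd)

lemma BoundedMeasurable.iterate_beliefOp {F : M.Belief → ℝ} (hF : BoundedMeasurable F) (n : ℕ) :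
    BoundedMeasurable ((POMDP.beliefOp P π)^[n] F) := by
  induction n generalizing F with
  | zero => exact hF
  | succ n ih => exact ih hF.beliefOp

lemma abs_beliefOp_le {F : M.Belief → ℝ} {C : ℝ} (hC : ∀ b, |F b| ≤ C) (b : M.Belief) :
    |beliefOp P π F b| ≤ C := by
  simpa [beliefOp] using norm_integral_le_of_norm_le_const (μ := beliefKernel P π b) (f := F)
    (ae_of_all _ hC)

lemma abs_iterate_beliefOp_le {F : M.Belief → ℝ} {C : ℝ} (hC : ∀ b, |F b| ≤ C) (n : ℕ)
    (b : M.Belief) : |(beliefOp P π)^[n] F b| ≤ C := by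
  induction n generalizing F with
  | zero => exact hC b
  | succ n ih => exact ih (abs_beliefOp_le hC)

lemma beliefOp_eq_integral_stepLaw {F : M.Belief → ℝ} (hF : Measurable F) (b : M.Belief) :
    beliefOp P π F b = ∫ x, F x.2.2.2 ∂stepLaw P π b := by
  rw [beliefOp, beliefKernel, Kernel.map_apply _ (by fun_prop)]
  exact integral_map (Measurable.aemeasurable (by fun_prop)) hF.aestronglyMeasurable

lemma integral_comp_measure {X Y : Type*} [MeasurableSpace X] [MeasurableSpace Y]
    {κ : Kernel X Y} {μ : Measure X} [SFinite μ] [IsSFiniteKernel κ] {f : Y → ℝ}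
    (hf : Integrable f (κ ∘ₘ μ)) : ∫ y, f y ∂(κ ∘ₘ μ) = ∫ x, ∫ y, f y ∂κ x ∂μ := by
  rw [Measure.comp_eq_comp_const_apply] at hf ⊢
  rw [Kernel.integral_comp hf, Kernel.const_apply]

lemma integral_beliefLaw {F : M.Belief → ℝ} (hF : BoundedMeasurable F) (b : M.Belief) (n : ℕ) :
    ∫ b', F b' ∂beliefLaw P π b n = (beliefOp P π)^[n] F b := by
  induction n generalizing F with
  | zero => exact integral_dirac' _ _ hF.1.stronglyMeasurable
  | succ n ih =>
    rw [Function.iterate_succ_apply, ← ih hF.beliefOp, beliefLaw,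
      integral_comp_measure (hF.integrable _)]
    rfl

/-- The expected cost of a single step from `b`. -/
noncomputable def expectedStepCost (P : M.AgentModel) (w : Weights) (π : M.Policy)
    (b : M.Belief) : ℝ :=
  ∫ x, stepCost P w π x ∂stepLaw P π b

lemma boundedMeasurable_expectedStepCost (hM : M.Regular) (hP : P.BoundedInfoGain)
    (hw : w.Valid) : BoundedMeasurable (expectedStepCost P w π) := by
  obtain ⟨C, hC⟩ := exists_integral_abs_stepCost_le (P := P) hM hP hw π
  exact BoundedMeasurable.integral_kernel_of_integral_abs_le _
    ((measurable_stepCost P w π).comp measurable_snd) hC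

lemma integrable_stepCost_comp (hM : M.Regular) (hP : P.BoundedInfoGain)
    (hw : w.Valid) (μ : Measure M.Belief) [IsProbabilityMeasure μ] :
    Integrable (stepCost P w π) (stepLaw P π ∘ₘ μ) := by
  obtain ⟨C, hC⟩ := exists_integral_abs_stepCost_le (P := P) hM hP hw π
  have hm := measurable_stepCost P w π
  rw [Measure.integrable_comp_iff hm.aestronglyMeasurable]
  refine ⟨ae_of_all _ fun b => integrable_stepCost hM hP hw b, ?_⟩
  exact (BoundedMeasurable.integral_kernel_of_integral_abs_le (stepLaw P π)
    (h := fun _ x => |stepCost P w π x|) (C := C) (hm.comp measurable_snd).abs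
    (by simpa only [abs_abs] using hC)).integrable μ

/-- The expected free energy is the discounted sum of the expected costs of the steps. -/
lemma hasSum_efe (hM : M.Regular) (hP : P.BoundedInfoGain) (hw : w.Valid) (b : M.Belief) :
    HasSum (fun n => w.γ ^ n * (beliefOp P π)^[n] (expectedStepCost P w π) b)
      (efe P w π b) := by
  obtain ⟨C, hC⟩ := exists_integral_abs_stepCost_le (P := P) hM hP hw π
  have hm := measurable_stepCost P w π
  have hcomp : ∀ n, Integrable (stepCost P w π) (stepLaw P π ∘ₘ beliefLaw P π b n) :=
    fun n => integrable_stepCost_comp hM hP hw _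
  have hint : ∀ n, Integrable (fun x : ℕ → M.Step => stepCost P w π (x n))
      (trajLaw P π b) := fun n => by
    have h := hcomp n
    rw [← map_eval_trajLaw] at h
    exact h.comp_measurable (by fun_prop)
  have heval : ∀ (n : ℕ) (f : M.Step → ℝ), Measurable f →
      ∫ x, f (x n) ∂trajLaw P π b = ∫ x, f x ∂(stepLaw P π ∘ₘ beliefLaw P π b n) :=
    fun n f hf => by
      rw [← map_eval_trajLaw, integral_map (Measurable.aemeasurable (by fun_prop))
        hf.aestronglyMeasurable]
  have hval : ∀ n, ∫ x, w.γ ^ n * stepCost P w π (x n) ∂trajLaw P π b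
      = w.γ ^ n * (beliefOp P π)^[n] (expectedStepCost P w π) b := fun n => by
    rw [integral_const_mul, heval n _ hm, integral_comp_measure (hcomp n),
      ← integral_beliefLaw (boundedMeasurable_expectedStepCost hM hP hw)]
    rfl
  have hbound : ∀ n, ∫ x, ‖w.γ ^ n * stepCost P w π (x n)‖ ∂trajLaw P π b ≤ w.γ ^ n * C :=
    fun n => by
      simp only [norm_mul, Real.norm_eq_abs, abs_pow, abs_of_nonneg hw.γ_nonneg]
      rw [integral_const_mul, heval n _ hm.abs, integral_comp_measure (hcomp n).abs]
      refine mul_le_mul_of_nonneg_left ?_ (pow_nonneg hw.γ_nonneg n)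
      have h := (Measure.integrable_comp_iff hm.aestronglyMeasurable).1 (hcomp n)
      simpa using integral_mono h.2 (integrable_const C) hC
  have hsum : Summable fun n => ∫ x, ‖w.γ ^ n * stepCost P w π (x n)‖ ∂trajLaw P π b :=
    Summable.of_nonneg_of_le (fun n => integral_nonneg fun _ => norm_nonneg _) hbound
      ((summable_geometric_of_lt_one hw.γ_nonneg hw.γ_lt_one).mul_right C)
  simpa only [hval, efe] using
    hasSum_integral_of_summable_integral_norm (fun n => (hint n).const_mul (w.γ ^ n)) hsum

lemma boundedMeasurable_efe (hM : M.Regular) (hP : P.BoundedInfoGain) (hw : w.Valid)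
    (π : M.Policy) : BoundedMeasurable (efe P w π) := by
  have hC := boundedMeasurable_expectedStepCost (π := π) hM hP hw
  refine ⟨?_, ?_⟩
  · refine measurable_of_tendsto_metrizable (f := fun n b => ∑ i ∈ Finset.range n,
      w.γ ^ i * (beliefOp P π)^[i] (expectedStepCost P w π) b)
      (fun n => Finset.measurable_fun_sum _ fun i _ =>
        ((hC.iterate_beliefOp i).1.const_mul _)) ?_
    exact tendsto_pi_nhds.2 fun b => (hasSum_efe hM hP hw b).tendsto_sum_nat
  · obtain ⟨C, hC⟩ := hC.2
    have hg := (hasSum_geometric_of_lt_one hw.γ_nonneg hw.γ_lt_one).mul_right C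
    refine ⟨(1 - w.γ)⁻¹ * C, fun b => ?_⟩
    rw [← (hasSum_efe (π := π) hM hP hw b).tsum_eq]
    rw [← Real.norm_eq_abs]
    refine tsum_of_norm_bounded hg fun n => ?_
    rw [norm_mul, norm_pow, Real.norm_of_nonneg hw.γ_nonneg]
    exact mul_le_mul_of_nonneg_left (abs_iterate_beliefOp_le hC n b) (pow_nonneg hw.γ_nonneg n)

/-- The Bellman equation of the policy `π`. -/
lemma efe_eq_value_actionEfe (hM : M.Regular) (hP : P.BoundedInfoGain) (hw : w.Valid)
    (b : M.Belief) : efe P w π b = value w π (actionEfe P w π) b := by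
  have hefe := boundedMeasurable_efe hM hP hw π
  have hC := boundedMeasurable_expectedStepCost (π := π) hM hP hw
  obtain ⟨C, hC'⟩ := hC.2
  -- Integrate the series for `efe` term by term over the next belief.
  have hop : HasSum (fun n => w.γ ^ n * (beliefOp P π)^[n + 1] (expectedStepCost P w π) b)
      (beliefOp P π (efe P w π) b) := by
    have hint : ∀ n, Integrable (fun b' => w.γ ^ n *
        (beliefOp P π)^[n] (expectedStepCost P w π) b') (beliefKernel P π b) :=
      fun n => ((hC.iterate_beliefOp n).integrable _).const_mul _
    have hsum : Summable fun n => ∫ b', ‖w.γ ^ n *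
        (beliefOp P π)^[n] (expectedStepCost P w π) b'‖ ∂beliefKernel P π b := by
      refine Summable.of_nonneg_of_le (fun n => integral_nonneg fun _ => norm_nonneg _)
        (fun n => ?_) ((summable_geometric_of_lt_one hw.γ_nonneg hw.γ_lt_one).mul_right C)
      have h : ∀ b', ‖w.γ ^ n * (beliefOp P π)^[n] (expectedStepCost P w π) b'‖
          ≤ w.γ ^ n * C := fun b' => by
        rw [norm_mul, norm_pow, Real.norm_of_nonneg hw.γ_nonneg]
        exact mul_le_mul_of_nonneg_left (abs_iterate_beliefOp_le hC' n b')
          (pow_nonneg hw.γ_nonneg n)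
      simpa using integral_mono (hint n).norm (integrable_const (w.γ ^ n * C)) h
    have h := hasSum_integral_of_summable_integral_norm hint hsum
    simp only [integral_const_mul, (hasSum_efe (π := π) hM hP hw _).tsum_eq] at h
    simpa only [Function.iterate_succ_apply', beliefOp] using h
  have h1 := hasSum_efe (π := π) hM hP hw b
  have h2 : HasSum (fun n => w.γ ^ (n + 1) *
      (beliefOp P π)^[n + 1] (expectedStepCost P w π) b)
      (w.γ * beliefOp P π (efe P w π) b) := by
    simpa only [pow_succ', mul_assoc] using hop.mul_left w.γ
  have h3 := (hasSum_nat_add_iff' 1).2 h1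
  have h4 := h3.unique h2
  have hF := (hefe.comp (Y := M.Step) (u := fun x => x.2.2.2) (by fun_prop)).integrable
    (stepLaw P π b)
  rw [actionEfe_eq_backup, ← integral_stepCost_add hM hP hw hefe,
    integral_add (integrable_stepCost hM hP hw b) (hF.const_mul _), integral_const_mul,
    ← beliefOp_eq_integral_stepLaw hefe.1, ← h4]
  simp [expectedStepCost]

end Trajectory

/-! ### Information projections minimize the free energy -/

section InfoProjection

variable {w : Weights} {g : M.Belief → M.A → ℝ}

lemma llr_ker_ae_eq (π : M.Policy) (b : M.Belief) :
    llr (π.ker b) M.refA =ᵐ[π.ker b] fun a => Real.log (π.density b a) := by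
  filter_upwards [(π.ac b).ae_eq (π.density_ae_eq_rnDeriv b)] with a ha
  rw [llr, ha]

/-- The divergence from the Boltzmann distribution is the free energy divided by `β`, up to the
log-partition function, which does not depend on the policy. -/
lemma toReal_klDiv_softmax (hw : w.Valid)
    (hg : BoundedMeasurable fun x : M.Belief × M.A => g x.1 x.2) (π : M.Policy) (b : M.Belief) :
    InformationTheory.klDiv (π.ker b) (softmax w g b) ≠ ⊤ ∧
    (InformationTheory.klDiv (π.ker b) (softmax w g b)).toReal
      = value w π g b / w.β + Real.log (∫ a, Real.exp (-g b a / w.β) ∂M.refA) := by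
  have : NeZero M.refA := ⟨M.refA_ne_zero⟩
  have hgb : BoundedMeasurable (g b) := hg.comp measurable_prodMk_left
  have hf : BoundedMeasurable fun a => -g b a / w.β := by
    simpa [neg_div, div_eq_inv_mul] using hgb.const_mul (-w.β⁻¹)
  have hexp : Integrable (fun a => Real.exp (-g b a / w.β)) M.refA := by
    obtain ⟨C, hC⟩ := hf.2
    exact Integrable.of_bound (Real.measurable_exp.comp hf.1).aestronglyMeasurable (Real.exp C)
      (ae_of_all _ fun a => by
        rw [Real.norm_of_nonneg (Real.exp_nonneg _)]
        exact Real.exp_le_exp.2 (abs_le.1 (hC a)).2)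
  have hprob : IsProbabilityMeasure (softmax w g b) := isProbabilityMeasure_tilted hexp
  have hac : π.ker b ≪ softmax w g b := (π.ac b).trans (absolutelyContinuous_tilted hexp)
  have hllr : Integrable (llr (π.ker b) M.refA) (π.ker b) :=
    (integrable_congr (llr_ker_ae_eq π b)).2 (π.integrable_log_density b)
  have hint : Integrable (llr (π.ker b) (softmax w g b)) (π.ker b) :=
    integrable_llr_tilted_right (π.ac b) (hf.integrable _) hllr hexp
  refine ⟨InformationTheory.klDiv_ne_top hac hint, ?_⟩
  rw [InformationTheory.toReal_klDiv_of_measure_eq hac (by simp), softmax,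
    integral_llr_tilted_right (π.ac b) (hf.integrable _) hexp hllr,
    integral_congr_ae (llr_ker_ae_eq π b), value_eq hg, integral_div, integral_neg]
  have := hw.β_pos.ne'
  field_simp
  ring

lemma IsInfoProjection.value_le (hw : w.Valid) {Pi : Set M.Policy}
    (hg : BoundedMeasurable fun x : M.Belief × M.A => g x.1 x.2) {π π' : M.Policy}
    (h : IsInfoProjection w Pi g π) (hπ' : π' ∈ Pi) (b : M.Belief) :
    value w π g b ≤ value w π' g b := by
  obtain ⟨h1, h2⟩ := toReal_klDiv_softmax hw hg π b
  obtain ⟨h1', h2'⟩ := toReal_klDiv_softmax hw hg π' b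
  have h3 := (ENNReal.toReal_le_toReal h1 h1').2 (h.2 b π' hπ')
  rw [h2, h2', add_le_add_iff_right] at h3
  exact (div_le_div_iff_of_pos_right hw.β_pos).1 h3

end InfoProjection

/-! ### The limit of the iteration -/

section Bellman

variable {P : M.AgentModel} {w : Weights} {π : M.Policy} {g g' : M.Belief → M.A → ℝ}

lemma boundedMeasurable_bellman (hM : M.Regular) (hP : P.BoundedInfoGain)
    (hg : BoundedMeasurable fun x : M.Belief × M.A => g x.1 x.2) :
    BoundedMeasurable fun x : M.Belief × M.A => bellman P w π g x.1 x.2 :=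
  boundedMeasurable_backup hM hP (boundedMeasurable_value hg)

lemma boundedMeasurable_actionEfe (hM : M.Regular) (hP : P.BoundedInfoGain) (hw : w.Valid)
    (π : M.Policy) : BoundedMeasurable fun x : M.Belief × M.A => actionEfe P w π x.1 x.2 :=
  boundedMeasurable_backup hM hP (boundedMeasurable_efe hM hP hw π)

/-- The Bellman operator is monotone, and shifts constants by the factor `γ`. -/
lemma bellman_le_bellman_add (hM : M.Regular) (hP : P.BoundedInfoGain) (hw : w.Valid)
    (hg : BoundedMeasurable fun x : M.Belief × M.A => g x.1 x.2)
    (hg' : BoundedMeasurable fun x : M.Belief × M.A => g' x.1 x.2) {δ : ℝ}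
    (h : ∀ b a, g b a ≤ g' b a + δ) (b : M.Belief) (a : M.A) :
    bellman P w π g b a ≤ bellman P w π g' b a + w.γ * δ :=
  backup_le_backup_add hM hP hw (boundedMeasurable_value hg) (boundedMeasurable_value hg')
    fun b => value_le_value_add hg hg' (h b)

lemma bellman_actionEfe (hM : M.Regular) (hP : P.BoundedInfoGain) (hw : w.Valid) :
    bellman P w π (actionEfe P w π) = actionEfe P w π := by
  rw [bellman_eq_backup, ← funext (efe_eq_value_actionEfe hM hP hw), actionEfe_eq_backup]

/-- Comparison of approximate sub- and supersolutions of the Bellman equation. -/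
lemma le_add_of_le_bellman_of_bellman_le (hM : M.Regular) (hP : P.BoundedInfoGain)
    (hw : w.Valid) (hg : BoundedMeasurable fun x : M.Belief × M.A => g x.1 x.2)
    (hg' : BoundedMeasurable fun x : M.Belief × M.A => g' x.1 x.2) {η : ℝ} (hη : 0 ≤ η)
    (h : ∀ b a, g b a ≤ bellman P w π g b a + η)
    (h' : ∀ b a, bellman P w π g' b a ≤ g' b a) (b : M.Belief) (a : M.A) :
    g b a ≤ g' b a + η / (1 - w.γ) := by
  have hγ : 0 < 1 - w.γ := sub_pos.2 hw.γ_lt_one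
  obtain ⟨C, hC⟩ := hg.2
  obtain ⟨C', hC'⟩ := hg'.2
  -- Each application of the operator shrinks the part of the gap that is not due to `η`.
  have key : ∀ n : ℕ, ∀ b a, g b a ≤ g' b a + (w.γ ^ n * (C + C') + η / (1 - w.γ)) := by
    intro n
    induction n with
    | zero =>
      intro b a
      have h1 := (abs_le.1 (hC (b, a))).2
      have h2 := (abs_le.1 (hC' (b, a))).1
      have h3 : 0 ≤ η / (1 - w.γ) := by positivity
      simp only at h1 h2
      linarith
    | succ n ih =>
      intro b a
      have h1 := bellman_le_bellman_add (π := π) hM hP hw hg hg' ih b a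
      have h2 : w.γ * (w.γ ^ n * (C + C') + η / (1 - w.γ)) + η
          = w.γ ^ (n + 1) * (C + C') + η / (1 - w.γ) := by
        field_simp
        ring
      linarith [h b a, h' b a]
  have hlim : Filter.Tendsto (fun n : ℕ => g' b a + (w.γ ^ n * (C + C') + η / (1 - w.γ)))
      Filter.atTop (nhds (g' b a + (0 * (C + C') + η / (1 - w.γ)))) :=
    (((tendsto_pow_atTop_nhds_zero_of_lt_one hw.γ_nonneg hw.γ_lt_one).mul_const _).add_const
      _).const_add _
  rw [zero_mul, zero_add] at hlim
  exact ge_of_tendsto' hlim fun n => key n b a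

end Bellman

/-- What the iteration leaves in the limit: a function `H` on belief-action pairs such that the
iterates `π k` minimize, up to an error `ρ k → 0`, the free energy `value w · H` over the class,
and such that `H` is the limit of the iterates `G k` and of the action values of the `π k`. -/
structure IsIterationLimit (P : M.AgentModel) (w : Weights) (Pi : Set M.Policy)
    (π : ℕ → M.Policy) (G : ℕ → M.Belief → M.A → ℝ) (H : M.Belief → M.A → ℝ) (ρ : ℕ → ℝ) :
    Prop where
  boundedMeasurable : BoundedMeasurable fun x : M.Belief × M.A => H x.1 x.2
  tendsto_zero : Filter.Tendsto ρ Filter.atTop (nhds 0)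
  abs_iterate_sub_le : ∀ k b a, |G (k + 1) b a - H b a| ≤ ρ (k + 1)
  le_actionEfe : ∀ π' ∈ Pi, ∀ b a, H b a ≤ actionEfe P w π' b a
  actionEfe_le : ∀ k b a, actionEfe P w (π (k + 1)) b a ≤ H b a + ρ (k + 1)
  bellman_le : ∀ k b a, bellman P w (π (k + 1)) H b a ≤ H b a + ρ (k + 1)
  efe_le : ∀ k b, ∀ π' ∈ Pi, efe P w (π (k + 1)) b ≤ value w π' H b + ρ (k + 1)

section Limit

variable {P : M.AgentModel} {w : Weights} {Pi : Set M.Policy} {π : ℕ → M.Policy}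
  {G : ℕ → M.Belief → M.A → ℝ}

lemma boundedMeasurable_iterate (hM : M.Regular) (hP : P.BoundedInfoGain)
    (hG0 : BoundedMeasurable fun x : M.Belief × M.A => G 0 x.1 x.2)
    (hG : ∀ k, G (k + 1) = bellman P w (π k) (G k)) (k : ℕ) :
    BoundedMeasurable fun x : M.Belief × M.A => G k x.1 x.2 := by
  induction k with
  | zero => exact hG0
  | succ k ih => rw [hG]; exact boundedMeasurable_bellman hM hP ih

/-- Successive iterates approach each other geometrically: from the first step on, `G (k + 1)` is
obtained from `G k` by the Bellman optimality operator of the class, a contraction. -/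
lemma abs_iterate_succ_sub_le (hM : M.Regular) (hP : P.BoundedInfoGain) (hw : w.Valid)
    (hGb : ∀ k, BoundedMeasurable fun x : M.Belief × M.A => G k x.1 x.2)
    (hG : ∀ k, G (k + 1) = bellman P w (π k) (G k)) (hmem : ∀ k, π k ∈ Pi)
    (hmin : ∀ k, ∀ π' ∈ Pi, ∀ b,
      value w (π (k + 1)) (G (k + 1)) b ≤ value w π' (G (k + 1)) b) :
    ∃ D : ℝ, ∀ k b a, |G (k + 1) b a - G (k + 2) b a| ≤ D * w.γ ^ k := by
  obtain ⟨C₁, h₁⟩ := (hGb 1).2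
  obtain ⟨C₂, h₂⟩ := (hGb 2).2
  refine ⟨C₁ + C₂, fun k => ?_⟩
  induction k with
  | zero =>
    intro b a
    simpa using (abs_sub _ _).trans (add_le_add (h₁ (b, a)) (h₂ (b, a)))
  | succ k ih =>
    -- The minimizer for one iterate is a competitor for the other one.
    have step : ∀ i j, (∀ b a, G (i + 1) b a ≤ G (j + 1) b a + (C₁ + C₂) * w.γ ^ k) →
        ∀ b a, G (i + 2) b a ≤ G (j + 2) b a + w.γ * ((C₁ + C₂) * w.γ ^ k) := by
      intro i j hij b a
      rw [hG (i + 1), hG (j + 1)]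
      refine backup_le_backup_add hM hP hw (boundedMeasurable_value (hGb _))
        (boundedMeasurable_value (hGb _)) fun b => ?_
      exact (hmin i _ (hmem (j + 1)) b).trans (value_le_value_add (hGb _) (hGb _) (hij b))
    intro b a
    have h3 := step k (k + 1) (fun b a => by linarith [(abs_le.1 (ih b a)).2]) b a
    have h4 := step (k + 1) k (fun b a => by linarith [(abs_le.1 (ih b a)).1]) b a
    have h5 : (C₁ + C₂) * w.γ ^ (k + 1) = w.γ * ((C₁ + C₂) * w.γ ^ k) := by ring
    rw [h5, abs_le]
    constructor <;> linarith

lemma exists_isIterationLimit (hM : M.Regular) (hP : P.BoundedInfoGain) (hw : w.Valid)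
    (hG0 : BoundedMeasurable fun x : M.Belief × M.A => G 0 x.1 x.2)
    (hG : ∀ k, G (k + 1) = bellman P w (π k) (G k)) (hmem : ∀ k, π k ∈ Pi)
    (hπ : ∀ k, IsInfoProjection w Pi (G (k + 1)) (π (k + 1))) :
    ∃ H ρ, IsIterationLimit P w Pi π G H ρ := by
  have hγ : 0 < 1 - w.γ := sub_pos.2 hw.γ_lt_one
  have hGb := boundedMeasurable_iterate hM hP hG0 hG
  have hmin : ∀ k, ∀ π' ∈ Pi, ∀ b,
      value w (π (k + 1)) (G (k + 1)) b ≤ value w π' (G (k + 1)) b :=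
    fun k π' hπ' b => (hπ k).value_le hw (hGb _) hπ' b
  obtain ⟨D, hD⟩ := abs_iterate_succ_sub_le hM hP hw hGb hG hmem hmin
  have hgeom : ∀ b a k, dist (G (k + 1) b a) (G (k + 1 + 1) b a) ≤ D * w.γ ^ k :=
    fun b a k => hD k b a
  choose H hH using fun b a => cauchySeq_tendsto_of_complete
    (cauchySeq_of_le_geometric w.γ D hw.γ_lt_one (hgeom b a))
  set δ : ℕ → ℝ := fun k => |D| * w.γ ^ k / (1 - w.γ) with hδ
  have hδ0 : ∀ k, 0 ≤ δ k := fun k => by have := hw.γ_nonneg; positivity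
  have hδanti : ∀ k, δ (k + 1) ≤ δ k := fun k => by
    simp only [hδ]
    refine div_le_div_of_nonneg_right (mul_le_mul_of_nonneg_left ?_ (abs_nonneg D)) hγ.le
    exact pow_le_pow_of_le_one hw.γ_nonneg hw.γ_lt_one.le k.le_succ
  have hGH : ∀ k b a, |G (k + 1) b a - H b a| ≤ δ k := fun k b a => by
    refine (dist_le_of_le_geometric_of_tendsto w.γ D hw.γ_lt_one (hgeom b a) (hH b a) k).trans ?_
    refine div_le_div_of_nonneg_right ?_ hγ.le
    exact mul_le_mul_of_nonneg_right (le_abs_self D) (pow_nonneg hw.γ_nonneg k)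
  have hδlim : Filter.Tendsto δ Filter.atTop (nhds 0) := by
    simpa using ((tendsto_pow_atTop_nhds_zero_of_lt_one hw.γ_nonneg hw.γ_lt_one).const_mul
      |D|).div_const (1 - w.γ)
  have hHb : BoundedMeasurable fun x : M.Belief × M.A => H x.1 x.2 := by
    refine ⟨measurable_of_tendsto_metrizable (fun k => (hGb (k + 1)).1)
      (tendsto_pi_nhds.2 fun x => hH x.1 x.2), ?_⟩
    obtain ⟨C, hC⟩ := (hGb 1).2
    refine ⟨C + δ 0, fun x => ?_⟩
    have h1 := abs_le.1 (hGH 0 x.1 x.2)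
    have h2 := abs_le.1 (hC x)
    simp only [zero_add] at h1
    exact abs_le.2 ⟨by linarith, by linarith⟩
  have hHG : ∀ k b a, H b a ≤ G (k + 1) b a + δ k := fun k b a => by
    linarith [(abs_le.1 (hGH k b a)).1]
  have hGH' : ∀ k b a, G (k + 1) b a ≤ H b a + δ k := fun k b a => by
    linarith [(abs_le.1 (hGH k b a)).2]
  have hγδ : ∀ k, w.γ * δ k ≤ δ k := fun k => mul_le_of_le_one_left (hδ0 k) hw.γ_lt_one.le
  have hsub : ∀ π' ∈ Pi, ∀ b a, H b a ≤ bellman P w π' H b a := fun π' hπ' b a => by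
    have hle : ∀ k, H b a ≤ bellman P w π' H b a + 2 * δ k := fun k => by
      have h1 := hHG (k + 1) b a
      rw [hG (k + 1)] at h1
      have h2 := backup_le_backup_add (P := P) (a := a) (b := b) (δ := 0) hM hP hw
        (boundedMeasurable_value (hGb (k + 1))) (boundedMeasurable_value (hGb (k + 1)))
        (fun b => by simpa using hmin k π' hπ' b)
      have h3 := bellman_le_bellman_add (P := P) (π := π') hM hP hw (hGb (k + 1)) hHb (hGH' k) b a
      rw [← bellman_eq_backup, ← bellman_eq_backup] at h2
      linarith [hγδ k, hδanti k]
    have hlim := (hδlim.const_mul 2).const_add (bellman P w π' H b a)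
    rw [mul_zero, add_zero] at hlim
    exact ge_of_tendsto' hlim hle
  have hsuper : ∀ k b a, bellman P w (π (k + 1)) H b a ≤ H b a + 2 * δ k := fun k b a => by
    have h1 := hGH' (k + 1) b a
    rw [hG (k + 1)] at h1
    have h3 := bellman_le_bellman_add (P := P) (π := π (k + 1)) hM hP hw hHb (hGb (k + 1))
      (hHG k) b a
    linarith [hγδ k, hδanti k]
  have hact : ∀ k b a, actionEfe P w (π (k + 1)) b a ≤ H b a + 2 * δ k / (1 - w.γ) := by
    intro k
    -- `H + 2δ / (1 - γ)` is a supersolution of the Bellman equation of `π (k + 1)`.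
    have hHs : BoundedMeasurable fun x : M.Belief × M.A => H x.1 x.2 + 2 * δ k / (1 - w.γ) :=
      hHb.add ⟨measurable_const, |2 * δ k / (1 - w.γ)|, fun _ => le_rfl⟩
    have h := le_add_of_le_bellman_of_bellman_le (P := P) (π := π (k + 1)) (η := 0)
      (g' := fun b a => H b a + 2 * δ k / (1 - w.γ)) hM hP hw
      (boundedMeasurable_actionEfe hM hP hw (π (k + 1))) hHs le_rfl
      (fun b a => by rw [bellman_actionEfe hM hP hw, add_zero]) (fun b a => ?_)
    · simpa using h
    · have h1 := bellman_le_bellman_add (P := P) (π := π (k + 1)) hM hP hw hHs hHb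
        (fun b a => le_refl (H b a + 2 * δ k / (1 - w.γ))) b a
      have h2 : 2 * δ k + w.γ * (2 * δ k / (1 - w.γ)) = 2 * δ k / (1 - w.γ) := by
        field_simp
        ring
      linarith [hsuper k b a]
  have hle_div : ∀ k, 2 * δ k ≤ 2 * δ k / (1 - w.γ) := fun k =>
    le_div_self (by linarith [hδ0 k]) hγ (by linarith [hw.γ_nonneg])
  refine ⟨H, fun k => 2 * δ (k - 1) + 2 * δ (k - 1) / (1 - w.γ), hHb, ?_, ?_, ?_, ?_, ?_, ?_⟩
  · have h := hδlim.comp (Filter.tendsto_sub_atTop_nat 1)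
    simpa [Function.comp_def] using (h.const_mul 2).add ((h.const_mul 2).div_const (1 - w.γ))
  · intro k b a
    simp only [Nat.add_sub_cancel]
    linarith [hGH k b a, hle_div k, hδ0 k]
  · intro π' hπ' b a
    have h := le_add_of_le_bellman_of_bellman_le (P := P) (π := π') (η := 0) hM hP hw hHb
      (boundedMeasurable_actionEfe hM hP hw π') le_rfl
      (fun b a => by simpa using hsub π' hπ' b a)
      (fun b a => by rw [bellman_actionEfe hM hP hw]) b a
    simpa using h
  · intro k b a
    simp only [Nat.add_sub_cancel]
    linarith [hact k b a, hδ0 k]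
  · intro k b a
    simp only [Nat.add_sub_cancel]
    linarith [hsuper k b a, hle_div k, hδ0 k]
  · intro k b π' hπ'
    simp only [Nat.add_sub_cancel]
    have h1 := value_le_value_add (w := w) (π := π (k + 1)) (b := b)
      (boundedMeasurable_actionEfe hM hP hw (π (k + 1))) hHb (hact k b)
    have h2 := value_le_value_add (w := w) (π := π (k + 1)) (b := b) hHb (hGb (k + 1)) (hHG k b)
    have h3 := hmin k π' hπ' b
    have h4 := value_le_value_add (w := w) (π := π') (b := b) (hGb (k + 1)) hHb (hGH' k b)
    rw [efe_eq_value_actionEfe hM hP hw]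
    linarith

namespace IsIterationLimit

variable {H : M.Belief → M.A → ℝ} {ρ : ℕ → ℝ}

lemma value_le_efe (h : IsIterationLimit P w Pi π G H ρ) (hM : M.Regular)
    (hP : P.BoundedInfoGain) (hw : w.Valid) {π' : M.Policy} (hπ' : π' ∈ Pi) (b : M.Belief) :
    value w π' H b ≤ efe P w π' b := by
  rw [efe_eq_value_actionEfe hM hP hw]
  simpa using value_le_value_add (w := w) (π := π') (δ := 0) h.boundedMeasurable
    (boundedMeasurable_actionEfe hM hP hw π') fun a => by simpa using h.le_actionEfe π' hπ' b a

lemma tendsto_const_add (h : IsIterationLimit P w Pi π G H ρ) (c : ℝ) :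
    Filter.Tendsto (fun k => c + ρ (k + 1)) Filter.atTop (nhds c) := by
  simpa using (h.tendsto_zero.comp (Filter.tendsto_add_atTop_nat 1)).const_add c

lemma eventually_le (h : IsIterationLimit P w Pi π G H ρ) {ε : ℝ} (hε : 0 < ε) :
    ∃ N, ∀ k ≥ N, ρ (k + 1) ≤ ε :=
  Filter.eventually_atTop.1 <|
    ((h.tendsto_zero.comp (Filter.tendsto_add_atTop_nat 1)).eventually_lt_const hε).mono
      fun _ => le_of_lt

lemma actionEfe_eq (h : IsIterationLimit P w Pi π G H ρ) (hM : M.Regular)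
    (hP : P.BoundedInfoGain) (hw : w.Valid) (hmem : ∀ k, π k ∈ Pi) {πopt : M.Policy}
    (hopt : IsOptimal P w Pi πopt) (b : M.Belief) (a : M.A) :
    actionEfe P w πopt b a = H b a := by
  refine le_antisymm (ge_of_tendsto' (h.tendsto_const_add (H b a)) fun k => ?_)
    (h.le_actionEfe πopt hopt.1 b a)
  refine le_trans ?_ (h.actionEfe_le k b a)
  have := backup_le_backup_add (P := P) (a := a) (b := b) (δ := 0) hM hP hw
    (boundedMeasurable_efe hM hP hw πopt) (boundedMeasurable_efe hM hP hw (π (k + 1)))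
    (fun b => by simpa using hopt.2 b _ (hmem (k + 1)))
  simpa [actionEfe_eq_backup] using this

lemma value_le_of_isOptimal (h : IsIterationLimit P w Pi π G H ρ) (hM : M.Regular)
    (hP : P.BoundedInfoGain) (hw : w.Valid) (hmem : ∀ k, π k ∈ Pi) {πopt π' : M.Policy}
    (hopt : IsOptimal P w Pi πopt) (hπ' : π' ∈ Pi) (b : M.Belief) :
    value w πopt H b ≤ value w π' H b :=
  ge_of_tendsto' (h.tendsto_const_add (value w π' H b)) fun k =>
    (h.value_le_efe hM hP hw hopt.1 b).trans <|
      (hopt.2 b _ (hmem (k + 1))).trans (h.efe_le k b π' hπ')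

lemma value_iterate_le (h : IsIterationLimit P w Pi π G H ρ) (hM : M.Regular)
    (hP : P.BoundedInfoGain) (hw : w.Valid) (hmem : ∀ k, π k ∈ Pi) (k : ℕ) {π' : M.Policy}
    (hπ' : π' ∈ Pi) (b : M.Belief) :
    value w (π (k + 1)) H b ≤ value w π' H b + ρ (k + 1) :=
  (h.value_le_efe hM hP hw (hmem _) b).trans (h.efe_le k b π' hπ')

/-- A policy of the class that minimizes the free energy for the limit `H` is optimal. -/
lemma isOptimal_of_value_le (h : IsIterationLimit P w Pi π G H ρ) (hM : M.Regular)
    (hP : P.BoundedInfoGain) (hw : w.Valid) (hmem : ∀ k, π k ∈ Pi) {πopt : M.Policy}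
    (hopt : πopt ∈ Pi) (hle : ∀ b, ∀ π' ∈ Pi, value w πopt H b ≤ value w π' H b) :
    IsOptimal P w Pi πopt := by
  have hsuper : ∀ b a, bellman P w πopt H b a ≤ H b a := fun b a => by
    refine ge_of_tendsto' (h.tendsto_const_add (H b a)) fun k => ?_
    refine le_trans ?_ (h.bellman_le k b a)
    have := backup_le_backup_add (P := P) (a := a) (b := b) (δ := 0) hM hP hw
      (boundedMeasurable_value (w := w) (π := πopt) h.boundedMeasurable)
      (boundedMeasurable_value (w := w) (π := π (k + 1)) h.boundedMeasurable)
      (fun b => by simpa using hle b _ (hmem (k + 1)))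
    simpa [bellman_eq_backup] using this
  have hact := le_add_of_le_bellman_of_bellman_le (P := P) (π := πopt) (η := 0) hM hP hw
    (boundedMeasurable_actionEfe hM hP hw πopt) h.boundedMeasurable le_rfl
    (fun b a => by rw [bellman_actionEfe hM hP hw, add_zero]) hsuper
  rw [zero_div] at hact
  refine ⟨hopt, fun b π' hπ' => ?_⟩
  have h1 := value_le_value_add (w := w) (π := πopt) (b := b)
    (boundedMeasurable_actionEfe hM hP hw πopt) h.boundedMeasurable (hact b)
  rw [← efe_eq_value_actionEfe hM hP hw] at h1
  linarith [hle b π' hπ', h.value_le_efe hM hP hw hπ' b]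

end IsIterationLimit

end Limit

/-! ### Strict convexity of the free energy -/

lemma sub_le_mul_log_sub_log {u v : ℝ} (hu : 0 ≤ u) (hv : 0 < v) :
    u - v ≤ u * (Real.log u - Real.log v) := by
  rcases hu.eq_or_lt with rfl | hu
  · simpa using hv.le
  · have h1 := Real.log_le_sub_one_of_pos (div_pos hv hu)
    rw [Real.log_div hv.ne' hu.ne'] at h1
    have h2 := mul_le_mul_of_nonneg_left h1 hu.le
    have h3 : u * (v / u - 1) = v - u := by field_simp
    linarith

/-- The convexity gap of `x log x` at a midpoint dominates the squared differences of the square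
roots, hence, up to a small multiple of `x + y`, the distance `|x - y|`. -/
lemma mul_log_midpoint_gap {x y : ℝ} (hx : 0 ≤ x) (hy : 0 ≤ y) {s : ℝ} (hs : 0 ≤ s) :
    2 * s * |x - y| - 4 * s ^ 2 * (x + y) ≤ x * Real.log x + y * Real.log y
      - 2 * ((x + y) / 2 * Real.log ((x + y) / 2)) := by
  rcases (add_nonneg hx hy).eq_or_lt with h0 | h0
  · obtain rfl : x = 0 := by linarith
    obtain rfl : y = 0 := by linarith
    simp
  set m := (x + y) / 2 with hm
  have hm0 : 0 < m := by positivity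
  obtain ⟨v, hv, hvm⟩ : ∃ v : ℝ, 0 < v ∧ v ^ 2 = m :=
    ⟨√m, Real.sqrt_pos.2 hm0, Real.sq_sqrt hm0.le⟩
  have key : ∀ z : ℝ, 0 ≤ z →
      2 * s * |z - m| - 2 * s ^ 2 * (z + m) + (z - m) ≤ z * Real.log z - z * Real.log m := by
    intro z hz
    obtain ⟨u, hu, rfl⟩ : ∃ u : ℝ, 0 ≤ u ∧ u ^ 2 = z := ⟨√z, Real.sqrt_nonneg z, Real.sq_sqrt hz⟩
    have h1 := mul_le_mul_of_nonneg_left (sub_le_mul_log_sub_log hu hv) (by positivity : 0 ≤ 2 * u)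
    have h2 : |u ^ 2 - v ^ 2| = |u - v| * (u + v) := by
      rw [← abs_of_nonneg (add_nonneg hu hv.le), ← abs_mul]
      congr 1
      ring
    rw [← hvm, Real.log_pow, Real.log_pow, h2]
    push_cast
    nlinarith [sq_nonneg (|u - v| - s * (u + v)), sq_abs (u - v),
      mul_nonneg (sq_nonneg s) (sq_nonneg (u - v))]
  have h1 := key x hx
  have h2 := key y hy
  have h3 : |x - y| ≤ |x - m| + |y - m| := by
    rw [abs_sub_comm y m]
    exact abs_sub_le x m y
  have h4 := mul_le_mul_of_nonneg_left h3 (by positivity : 0 ≤ 2 * s)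
  have h5 : x + y = 2 * m := by rw [hm]; ring
  have h6 : (x + y) * Real.log m = 2 * (m * Real.log m) := by rw [h5]; ring
  have h7 : s ^ 2 * (x + y) = s ^ 2 * (2 * m) := by rw [h5]
  linarith

lemma abs_mul_log_midpoint_le {x y : ℝ} (hx : 0 ≤ x) (hy : 0 ≤ y) :
    |(x + y) / 2 * Real.log ((x + y) / 2)| ≤ |x * Real.log x| + |y * Real.log y| + 1 := by
  have h1 := mul_log_midpoint_gap hx hy le_rfl
  have h2 := neg_one_le_mul_log (by positivity : 0 ≤ (x + y) / 2)
  have h3 := le_abs_self (x * Real.log x)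
  have h4 := le_abs_self (y * Real.log y)
  have h5 := abs_nonneg (x * Real.log x)
  have h6 := abs_nonneg (y * Real.log y)
  rw [abs_le]
  constructor <;> linarith

lemma measurable_mul_log : Measurable fun x : ℝ => x * Real.log x :=
  measurable_id.mul Real.measurable_log

namespace Policy

lemma rnDeriv_toReal_ae_eq_of_eq_withDensity {κ : Kernel M.Belief M.A} [IsMarkovKernel κ]
    {b : M.Belief} {p : M.A → ℝ} (hp : Measurable p) (hp0 : ∀ a, 0 ≤ p a)
    (h : κ b = M.refA.withDensity fun a => ENNReal.ofReal (p a)) :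
    (fun a => (Kernel.rnDeriv κ (Kernel.const _ M.refA) b a).toReal) =ᵐ[M.refA] p := by
  have h1 := Measure.rnDeriv_withDensity M.refA hp.ennreal_ofReal
  rw [← h] at h1
  have h2 := Kernel.rnDeriv_eq_rnDeriv_measure (κ := κ) (η := Kernel.const _ M.refA) (a := b)
  rw [Kernel.const_apply] at h2
  filter_upwards [h1, h2] with a ha ha'
  rw [ha', ha, ENNReal.toReal_ofReal (hp0 a)]

/-- A jointly measurable family of probability densities with bounded entropies is the family of
densities of a policy. -/
lemma exists_of_density (p : M.Belief → M.A → ℝ)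
    (hp : Measurable fun x : M.Belief × M.A => p x.1 x.2) (hp0 : ∀ b a, 0 ≤ p b a)
    (hp1 : ∀ b, ∫⁻ a, ENNReal.ofReal (p b a) ∂M.refA = 1) {C : ℝ}
    (hint : ∀ b, Integrable (fun a => p b a * Real.log (p b a)) M.refA)
    (hC : ∀ b, |∫ a, p b a * Real.log (p b a) ∂M.refA| ≤ C) :
    ∃ π : M.Policy, (∀ b, π.ker b = M.refA.withDensity fun a => ENNReal.ofReal (p b a)) ∧
      ∀ b, π.density b =ᵐ[M.refA] p b := by
  have hpb : ∀ b, Measurable (p b) := fun b => hp.comp measurable_prodMk_left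
  set κ : Kernel M.Belief M.A :=
    Kernel.withDensity (Kernel.const _ M.refA) fun b a => ENNReal.ofReal (p b a) with hκ
  have hκb : ∀ b, κ b = M.refA.withDensity fun a => ENNReal.ofReal (p b a) := fun b => by
    rw [hκ, Kernel.withDensity_apply _ hp.ennreal_ofReal, Kernel.const_apply]
  have hmarkov : IsMarkovKernel κ := ⟨fun b => ⟨by simp [hκb, hp1]⟩⟩
  have hae := fun b => rnDeriv_toReal_ae_eq_of_eq_withDensity (hpb b) (hp0 b) (hκb b)
  have hac : ∀ b, κ b ≪ M.refA := fun b => by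
    rw [hκb]; exact withDensity_absolutelyContinuous _ _
  have hlog : ∀ b, (fun a => Real.log (Kernel.rnDeriv κ (Kernel.const _ M.refA) b a).toReal)
      =ᵐ[κ b] fun a => Real.log (p b a) := fun b => by
    filter_upwards [(hac b).ae_eq (hae b)] with a ha
    rw [ha]
  refine ⟨⟨κ, hmarkov, hac, C, fun b => ?_⟩, hκb, hae⟩
  rw [integrable_congr (hlog b), integral_congr_ae (hlog b), hκb,
    integrable_withDensity_iff_integrable_smul' (hpb b).ennreal_ofReal (by simp),
    integral_withDensity_eq_integral_toReal_smul (hpb b).ennreal_ofReal (by simp)]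
  simpa [ENNReal.toReal_ofReal (hp0 b _)] using ⟨hint b, hC b⟩

lemma lintegral_density (π : M.Policy) (b : M.Belief) :
    ∫⁻ a, ENNReal.ofReal (π.density b a) ∂M.refA = 1 := by
  rw [← setLIntegral_univ, ← withDensity_apply _ MeasurableSet.univ, ← π.ker_eq_withDensity,
    measure_univ]

/-- The equal mixture of two policies. -/
lemma exists_midpoint (π₁ π₂ : M.Policy) : ∃ π : M.Policy,
    (∀ b, π.ker b = ENNReal.ofReal (1 / 2) • π₁.ker b
      + ENNReal.ofReal (1 - 1 / 2) • π₂.ker b) ∧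
    ∀ b, π.density b =ᵐ[M.refA] fun a => (π₁.density b a + π₂.density b a) / 2 := by
  have h₁ := π₁.density_nonneg
  have h₂ := π₂.density_nonneg
  have hsplit : ∀ b a, ENNReal.ofReal ((π₁.density b a + π₂.density b a) / 2)
      = ENNReal.ofReal (1 / 2) * ENNReal.ofReal (π₁.density b a)
        + ENNReal.ofReal (1 - 1 / 2) * ENNReal.ofReal (π₂.density b a) := fun b a => by
    rw [← ENNReal.ofReal_mul (by norm_num), ← ENNReal.ofReal_mul (by norm_num),
      ← ENNReal.ofReal_add (mul_nonneg (by norm_num) (h₁ b a))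
        (mul_nonneg (by norm_num) (h₂ b a))]
    congr 1
    ring
  have hm₁ := fun b => (π₁.measurable_density_right b).ennreal_ofReal
  have hm₂ := fun b => (π₂.measurable_density_right b).ennreal_ofReal
  have hm : Measurable fun x : M.Belief × M.A =>
      (π₁.density x.1 x.2 + π₂.density x.1 x.2) / 2 :=
    (π₁.measurable_density.add π₂.measurable_density).div_const 2
  have hi₁ := fun b => (π₁.integrable_density_mul_log b).abs
  have hi₂ := fun b => (π₂.integrable_density_mul_log b).abs
  have habs : ∀ π : M.Policy, ∃ C : ℝ, ∀ b,
      ∫ a, |π.density b a * Real.log (π.density b a)| ∂M.refA ≤ C := fun π => by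
    obtain ⟨C, hC⟩ := π.exists_integral_abs_log_density_le
    refine ⟨C, fun b => (hC b).trans' (le_of_eq ?_)⟩
    rw [integral_ker]
    simp only [abs_mul, abs_of_nonneg (π.density_nonneg b _)]
  obtain ⟨C₁, hC₁⟩ := habs π₁
  obtain ⟨C₂, hC₂⟩ := habs π₂
  have hbd := fun b => ((hi₁ b).add (hi₂ b)).add (integrable_const (μ := M.refA) (1 : ℝ))
  have hint : ∀ b, Integrable (fun a => (π₁.density b a + π₂.density b a) / 2
      * Real.log ((π₁.density b a + π₂.density b a) / 2)) M.refA := fun b =>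
    (hbd b).mono' (measurable_mul_log.comp
      (hm.comp measurable_prodMk_left)).aestronglyMeasurable
      (ae_of_all _ fun a => abs_mul_log_midpoint_le (h₁ b a) (h₂ b a))
  have hone : ∀ b, ∫⁻ a, ENNReal.ofReal ((π₁.density b a + π₂.density b a) / 2) ∂M.refA = 1 :=
    fun b => by
    simp only [hsplit]
    rw [lintegral_add_left ((hm₁ b).const_mul _), lintegral_const_mul _ (hm₁ b),
      lintegral_const_mul _ (hm₂ b), π₁.lintegral_density, π₂.lintegral_density, mul_one, mul_one,
      ← ENNReal.ofReal_add (by norm_num) (by norm_num)]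
    norm_num
  have hent : ∀ b, |∫ a, (π₁.density b a + π₂.density b a) / 2
      * Real.log ((π₁.density b a + π₂.density b a) / 2) ∂M.refA|
      ≤ C₁ + C₂ + M.refA.real Set.univ := fun b => by
    refine abs_integral_le_integral_abs.trans ?_
    refine (integral_mono (hint b).abs (hbd b)
      fun a => abs_mul_log_midpoint_le (h₁ b a) (h₂ b a)).trans ?_
    rw [integral_add' ((hi₁ b).add (hi₂ b)) (integrable_const _),
      integral_add' (hi₁ b) (hi₂ b)]
    simpa using add_le_add (hC₁ b) (hC₂ b)
  obtain ⟨π, hker, hdens⟩ := exists_of_density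
    (fun b a => (π₁.density b a + π₂.density b a) / 2) hm
    (fun b a => by linarith [h₁ b a, h₂ b a]) hone hint hent
  refine ⟨π, fun b => ?_, hdens⟩
  rw [hker, π₁.ker_eq_withDensity, π₂.ker_eq_withDensity, ← withDensity_smul _ (hm₁ b),
    ← withDensity_smul _ (hm₂ b), ← withDensity_add_left ((hm₁ b).const_smul _)]
  congr 1
  ext a
  simpa using hsplit b a

end Policy

section NearMinimizers

variable {w : Weights} {g : M.Belief → M.A → ℝ}

lemma value_eq_integral_refA (hg : BoundedMeasurable fun x : M.Belief × M.A => g x.1 x.2)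
    (π : M.Policy) (b : M.Belief) :
    value w π g b = w.β * ∫ a, π.density b a * Real.log (π.density b a) ∂M.refA
      + ∫ a, π.density b a * g b a ∂M.refA := by
  rw [value_eq hg, π.integral_ker, π.integral_ker]

/-- Two near-minimizers of the free energy over a convex class have densities that are close in
`L¹`: otherwise their mixture would do better. -/
lemma integral_abs_density_sub_le (hw : w.Valid) {Pi : Set M.Policy} (hPi : ConvexClass Pi)
    (hg : BoundedMeasurable fun x : M.Belief × M.A => g x.1 x.2) {π₁ π₂ : M.Policy}
    (h₁ : π₁ ∈ Pi) (h₂ : π₂ ∈ Pi) {b : M.Belief} {s η : ℝ} (hs : 0 < s)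
    (hη₁ : ∀ π ∈ Pi, value w π₁ g b ≤ value w π g b + η)
    (hη₂ : ∀ π ∈ Pi, value w π₂ g b ≤ value w π g b + η) :
    ∫ a, |π₁.density b a - π₂.density b a| ∂M.refA ≤ η / (w.β * s) + 4 * s := by
  obtain ⟨π, hker, hdens⟩ := Policy.exists_midpoint π₁ π₂
  have hπ : π ∈ Pi := hPi π₁ h₁ π₂ h₂ (1 / 2) (by norm_num) (by norm_num) π hker
  have hi₁ := π₁.integrable_density b
  have hi₂ := π₂.integrable_density b
  have hl₁ := π₁.integrable_density_mul_log b
  have hl₂ := π₂.integrable_density_mul_log b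
  have hl := (integrable_congr (by filter_upwards [hdens b] with a ha; rw [ha])).1
    (π.integrable_density_mul_log b)
  have hlg : ∀ π : M.Policy, Integrable (fun a => π.density b a * g b a) M.refA := fun π =>
    (π.integrable_ker_iff b _).1 (hg.integrable_ker π b)
  have habs : Integrable (fun a => |π₁.density b a - π₂.density b a|) M.refA := (hi₁.sub hi₂).abs
  have hadd : Integrable (fun a => π₁.density b a + π₂.density b a) M.refA := hi₁.add hi₂
  have hgap := integral_mono
    (f := fun a => 2 * s * |π₁.density b a - π₂.density b a|
      - 4 * s ^ 2 * (π₁.density b a + π₂.density b a))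
    ((habs.const_mul (2 * s)).sub ((hi₁.add hi₂).const_mul (4 * s ^ 2)))
    ((hl₁.add hl₂).sub (hl.const_mul 2))
    (fun a => mul_log_midpoint_gap (π₁.density_nonneg b a) (π₂.density_nonneg b a) hs.le)
  have e1 : ∫ a, (2 * s * |π₁.density b a - π₂.density b a|
      - 4 * s ^ 2 * (π₁.density b a + π₂.density b a)) ∂M.refA
      = 2 * s * ∫ a, |π₁.density b a - π₂.density b a| ∂M.refA - 8 * s ^ 2 := by
    rw [integral_sub (habs.const_mul (2 * s)) (hadd.const_mul (4 * s ^ 2)), integral_const_mul,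
      integral_const_mul, integral_add hi₁ hi₂, π₁.integral_density, π₂.integral_density]
    ring
  have e2 : value w π g b = w.β * ∫ a, (π₁.density b a + π₂.density b a) / 2
      * Real.log ((π₁.density b a + π₂.density b a) / 2) ∂M.refA
      + (∫ a, π₁.density b a * g b a ∂M.refA + ∫ a, π₂.density b a * g b a ∂M.refA) / 2 := by
    rw [value_eq_integral_refA hg, ← integral_add (hlg π₁) (hlg π₂), ← integral_div]
    congr 1
    · congr 1
      exact integral_congr_ae (by filter_upwards [hdens b] with a ha; rw [ha])
    · refine integral_congr_ae ?_
      filter_upwards [hdens b] with a ha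
      rw [ha]
      ring
  rw [e1, integral_sub' (hl₁.add hl₂) (hl.const_mul 2), integral_add' hl₁ hl₂,
    integral_const_mul] at hgap
  have h3 := hη₁ π hπ
  have h4 := hη₂ π hπ
  rw [e2, value_eq_integral_refA hg] at h3 h4
  have h5 := mul_le_mul_of_nonneg_left hgap hw.β_pos.le
  have h6 : 0 < w.β * s := mul_pos hw.β_pos hs
  have h7 : w.β * s * ∫ a, |π₁.density b a - π₂.density b a| ∂M.refA ≤ η + w.β * s * (4 * s) := by
    linarith
  have h8 : η + w.β * s * (4 * s) = w.β * s * (η / (w.β * s) + 4 * s) := by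
    rw [mul_add, mul_div_cancel₀ _ h6.ne']
  rw [h8] at h7
  exact le_of_mul_le_mul_left h7 h6

/-- The total variation distance is at most the `L¹` distance of the densities. -/
lemma abs_real_sub_real_le (π₁ π₂ : M.Policy) (b : M.Belief) {E : Set M.A}
    (hE : MeasurableSet E) :
    |(π₁.ker b).real E - (π₂.ker b).real E|
      ≤ ∫ a, |π₁.density b a - π₂.density b a| ∂M.refA := by
  have hreal : ∀ π : M.Policy, (π.ker b).real E = ∫ a in E, π.density b a ∂M.refA := fun π => by
    rw [← integral_indicator_one hE, π.integral_ker, ← integral_indicator hE]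
    congr 1
    ext a
    by_cases ha : a ∈ E <;> simp [ha]
  have hi := (π₁.integrable_density b).sub (π₂.integrable_density b)
  rw [hreal, hreal, ← integral_sub (π₁.integrable_density b).integrableOn
    (π₂.integrable_density b).integrableOn]
  exact abs_integral_le_integral_abs.trans
    (setIntegral_le_integral hi.abs (ae_of_all _ fun a => abs_nonneg _))

/-- Limits in uniform total variation are unique. -/
lemma TendstoTV.unique {π : ℕ → M.Policy} {π₁ π₂ : M.Policy} (h₁ : TendstoTV π π₁)
    (h₂ : TendstoTV π π₂) : π₁ = π₂ := by
  refine Policy.ext fun b => Measure.ext fun E hE => ?_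
  refine (measureReal_eq_measureReal_iff).1 (eq_of_forall_dist_le fun ε hε => ?_)
  obtain ⟨N₁, hN₁⟩ := h₁ (ε / 2) (half_pos hε)
  obtain ⟨N₂, hN₂⟩ := h₂ (ε / 2) (half_pos hε)
  have h3 := abs_le.1 (hN₁ (max N₁ N₂) (le_max_left _ _) b E hE)
  have h4 := abs_le.1 (hN₂ (max N₁ N₂) (le_max_right _ _) b E hE)
  rw [Real.dist_eq, abs_le]
  constructor <;> linarith [h3.1, h3.2, h4.1, h4.2]

end NearMinimizers

section ConvexLimit

variable {P : M.AgentModel} {w : Weights} {Pi : Set M.Policy} {π : ℕ → M.Policy}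
  {G : ℕ → M.Belief → M.A → ℝ} {H : M.Belief → M.A → ℝ} {ρ : ℕ → ℝ}

/-- Over a convex class, the densities of the iterates are eventually `L¹`-close, uniformly in the
belief, to those of any policy of the class that nearly minimizes the free energy for `H`. -/
lemma IsIterationLimit.exists_integral_abs_density_sub_le
    (h : IsIterationLimit P w Pi π G H ρ) (hM : M.Regular) (hP : P.BoundedInfoGain)
    (hw : w.Valid) (hmem : ∀ k, π k ∈ Pi) (hPi : ConvexClass Pi) {ε : ℝ} (hε : 0 < ε) :
    ∃ η > 0, ∃ N, ∀ k ≥ N, ∀ π₂ ∈ Pi, ∀ b,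
      (∀ π' ∈ Pi, value w π₂ H b ≤ value w π' H b + η) →
      ∫ a, |(π k).density b a - π₂.density b a| ∂M.refA ≤ ε := by
  have hβ := hw.β_pos
  -- With `s = ε / 8`, this `η` makes both terms of the `L¹` bound equal to `ε / 2`.
  obtain ⟨N, hN⟩ := h.eventually_le (by positivity : 0 < w.β * (ε / 8) * (ε / 2))
  refine ⟨w.β * (ε / 8) * (ε / 2), by positivity, N + 1, fun k hk π₂ hπ₂ b hmin => ?_⟩
  obtain ⟨k, rfl⟩ : ∃ j, k = j + 1 := ⟨k - 1, by omega⟩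
  refine (integral_abs_density_sub_le hw hPi h.boundedMeasurable (hmem (k + 1)) hπ₂
    (by positivity : 0 < ε / 8) (fun π' hπ' => ?_) hmin).trans (le_of_eq ?_)
  · exact (h.value_iterate_le hM hP hw hmem k hπ' b).trans (by
      linarith [hN k (by omega)])
  · rw [mul_div_cancel_left₀ _ (by positivity)]
    ring

lemma IsIterationLimit.tendstoTV (h : IsIterationLimit P w Pi π G H ρ) (hM : M.Regular)
    (hP : P.BoundedInfoGain) (hw : w.Valid) (hmem : ∀ k, π k ∈ Pi) (hPi : ConvexClass Pi)
    {πopt : M.Policy} (hopt : IsOptimal P w Pi πopt) : TendstoTV π πopt := by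
  intro ε hε
  obtain ⟨η, hη, N, hN⟩ := h.exists_integral_abs_density_sub_le hM hP hw hmem hPi hε
  refine ⟨N, fun k hk b E hE => (abs_real_sub_real_le _ _ b hE).trans ?_⟩
  refine hN k hk πopt hopt.1 b fun π' hπ' => ?_
  linarith [h.value_le_of_isOptimal hM hP hw hmem hopt hπ' b]

lemma IsIterationLimit.exists_integral_abs_density_sub_iterate_le
    (h : IsIterationLimit P w Pi π G H ρ) (hM : M.Regular) (hP : P.BoundedInfoGain)
    (hw : w.Valid) (hmem : ∀ k, π k ∈ Pi) (hPi : ConvexClass Pi) {ε : ℝ} (hε : 0 < ε) :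
    ∃ N, ∀ k ≥ N, ∀ l ≥ N, ∀ b,
      ∫ a, |(π k).density b a - (π l).density b a| ∂M.refA ≤ ε := by
  obtain ⟨η, hη, N, hN⟩ := h.exists_integral_abs_density_sub_le hM hP hw hmem hPi hε
  obtain ⟨N', hN'⟩ := h.eventually_le hη
  refine ⟨max N (N' + 1), fun k hk l hl b => hN k (le_of_max_le_left hk) _ (hmem l) b ?_⟩
  obtain ⟨l, rfl⟩ : ∃ j, l = j + 1 := ⟨l - 1, by omega⟩
  intro π' hπ'
  linarith [h.value_iterate_le hM hP hw hmem l hπ' b, hN' l (by omega)]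

end ConvexLimit

end POMDP

/-- Fatou's lemma for real functions: a nonnegative almost everywhere limit is integrable, with
integral at most the limit of bounds for the integrals. -/
lemma MeasureTheory.integrable_and_integral_le_of_tendsto {X : Type*} [MeasurableSpace X]
    {μ : Measure X} {f : ℕ → X → ℝ} {g : X → ℝ} (hf : ∀ n, Integrable (f n) μ)
    (hf0 : ∀ n x, 0 ≤ f n x)
    (hlim : ∀ᵐ x ∂μ, Filter.Tendsto (fun n => f n x) Filter.atTop (nhds (g x)))
    {c : ℕ → ℝ} {C : ℝ} (hc : ∀ n, ∫ x, f n x ∂μ ≤ c n)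
    (hcC : Filter.Tendsto c Filter.atTop (nhds C)) :
    Integrable g μ ∧ ∫ x, g x ∂μ ≤ C := by
  have hg : AEStronglyMeasurable g μ :=
    aestronglyMeasurable_of_tendsto_ae Filter.atTop (fun n => (hf n).1) hlim
  have hg0 : 0 ≤ᵐ[μ] g := by
    filter_upwards [hlim] with x hx
    exact ge_of_tendsto' hx fun n => hf0 n x
  have hC0 : 0 ≤ C := ge_of_tendsto' hcC fun n => (integral_nonneg (hf0 n)).trans (hc n)
  have hle : ∫⁻ x, ENNReal.ofReal (g x) ∂μ ≤ ENNReal.ofReal C := by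
    calc ∫⁻ x, ENNReal.ofReal (g x) ∂μ
        = ∫⁻ x, Filter.liminf (fun n => ENNReal.ofReal (f n x)) Filter.atTop ∂μ := by
          refine lintegral_congr_ae ?_
          filter_upwards [hlim] with x hx
          exact ((ENNReal.continuous_ofReal.tendsto _).comp hx).liminf_eq.symm
      _ ≤ Filter.liminf (fun n => ∫⁻ x, ENNReal.ofReal (f n x) ∂μ) Filter.atTop :=
          lintegral_liminf_le' fun n => (hf n).1.aemeasurable.ennreal_ofReal
      _ ≤ Filter.liminf (fun n => ENNReal.ofReal (c n)) Filter.atTop := by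
          refine Filter.liminf_le_liminf (Filter.Eventually.of_forall fun n => ?_)
          rw [← ofReal_integral_eq_lintegral_ofReal (hf n) (ae_of_all _ (hf0 n))]
          exact ENNReal.ofReal_le_ofReal (hc n)
      _ = ENNReal.ofReal C := ((ENNReal.continuous_ofReal.tendsto _).comp hcC).liminf_eq
  have hint : Integrable g μ :=
    ⟨hg, (hasFiniteIntegral_iff_ofReal hg0).2 (hle.trans_lt ENNReal.ofReal_lt_top)⟩
  refine ⟨hint, ?_⟩
  rw [← ofReal_integral_eq_lintegral_ofReal hint hg0] at hle
  exact (ENNReal.ofReal_le_ofReal_iff hC0).1 hle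

namespace POMDP

variable {dS dO dA : ℕ} {M : POMDP dS dO dA}

/-! ### Existence of an optimal policy -/

/-- Densities that converge almost everywhere for each belief have a jointly measurable limit: the
upper limit, which is a limit wherever there is one and is always jointly measurable. -/
lemma exists_measurable_tendsto (σ : ℕ → M.Policy)
    (hσ : ∀ b, ∀ᵐ a ∂M.refA, ∃ l,
      Filter.Tendsto (fun i => (σ i).density b a) Filter.atTop (nhds l)) :
    ∃ p : M.Belief → M.A → ℝ, (Measurable fun x : M.Belief × M.A => p x.1 x.2) ∧
      (∀ b a, 0 ≤ p b a) ∧ ∀ b, ∀ᵐ a ∂M.refA,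
        Filter.Tendsto (fun i => (σ i).density b a) Filter.atTop (nhds (p b a)) := by
  refine ⟨fun b a =>
    (Filter.limsup (fun i => ENNReal.ofReal ((σ i).density b a)) Filter.atTop).toReal,
    (Measurable.limsup fun i => (σ i).measurable_density.ennreal_ofReal).ennreal_toReal,
    fun _ _ => ENNReal.toReal_nonneg, fun b => ?_⟩
  filter_upwards [hσ b] with a ⟨l, hl⟩
  have hl0 : 0 ≤ l := ge_of_tendsto' hl fun i => (σ i).density_nonneg b a
  have h := ((ENNReal.continuous_ofReal.tendsto _).comp hl).limsup_eq
  simp only [Function.comp_def] at h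
  simpa only [h, ENNReal.toReal_ofReal hl0] using hl

/-- Policies whose densities are `L¹`-Cauchy, uniformly in the belief, have a jointly measurable
limit density, which a subsequence approaches almost everywhere. -/
lemma exists_limit_density (σ : ℕ → M.Policy)
    (hσ : ∀ ε > 0, ∃ N, ∀ k ≥ N, ∀ l ≥ N, ∀ b,
      ∫ a, |(σ k).density b a - (σ l).density b a| ∂M.refA ≤ ε) :
    ∃ p : M.Belief → M.A → ℝ, (Measurable fun x : M.Belief × M.A => p x.1 x.2) ∧
      (∀ b a, 0 ≤ p b a) ∧ (∀ b, Integrable (p b) M.refA) ∧ (∀ b, ∫ a, p b a ∂M.refA = 1) ∧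
      (∀ ε > 0, ∃ N, ∀ k ≥ N, ∀ b, ∫ a, |(σ k).density b a - p b a| ∂M.refA ≤ ε) ∧
      ∃ φ : ℕ → ℕ, StrictMono φ ∧ ∀ b, ∀ᵐ a ∂M.refA,
        Filter.Tendsto (fun i => (σ (φ i)).density b a) Filter.atTop (nhds (p b a)) := by
  obtain ⟨φ, hφ, hφσ⟩ := Filter.extraction_forall_of_eventually
    (P := fun n N => ∀ k ≥ N, ∀ l ≥ N, ∀ b,
      ∫ a, |(σ k).density b a - (σ l).density b a| ∂M.refA ≤ (1 / 2) ^ (n + 1)) fun n => by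
    obtain ⟨N, hN⟩ := hσ ((1 / 2) ^ (n + 1)) (by positivity)
    filter_upwards [Filter.eventually_ge_atTop N] with N' hN' k hk l hl
    exact hN k (hN'.trans hk) l (hN'.trans hl)
  have hi := fun k b => (σ k).integrable_density b
  have hconv : ∀ b, ∀ᵐ a ∂M.refA, ∃ l,
      Filter.Tendsto (fun i => (σ (φ i)).density b a) Filter.atTop (nhds l) := fun b => by
    refine Lp.ae_tendsto_of_cauchy_eLpNorm (p := 1) (fun i => (hi (φ i) b).1) le_rfl
      (B := fun i => ENNReal.ofReal ((1 / 2) ^ i))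
      (Summable.tsum_ofReal_ne_top summable_geometric_two) fun N n m hn hm => ?_
    rw [eLpNorm_one_eq_lintegral_enorm,
      ← ofReal_integral_norm_eq_lintegral_enorm ((hi _ b).sub (hi _ b))]
    refine (ENNReal.ofReal_lt_ofReal_iff (by positivity)).2 ?_
    refine (hφσ N (φ n) (hφ.monotone hn) (φ m) (hφ.monotone hm) b).trans_lt ?_
    exact pow_lt_pow_right_of_lt_one₀ (by norm_num) (by norm_num) N.lt_succ_self
  obtain ⟨p, hpm, hp0, hlim⟩ := exists_measurable_tendsto (fun i => σ (φ i)) hconv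
  have hL1 : ∀ ε > 0, ∃ N, ∀ k ≥ N, ∀ b,
      Integrable (fun a => |(σ k).density b a - p b a|) M.refA ∧
        ∫ a, |(σ k).density b a - p b a| ∂M.refA ≤ ε := fun ε hε => by
    obtain ⟨N, hN⟩ := hσ ε hε
    refine ⟨N, fun k hk b => ?_⟩
    refine integrable_and_integral_le_of_tendsto
      (f := fun i a => |(σ k).density b a - (σ (φ (i + N))).density b a|) (c := fun _ => ε)
      (fun i => ((hi k b).sub (hi _ b)).abs) (fun i a => abs_nonneg _) ?_
      (fun i => hN k hk _ ((Nat.le_add_left N i).trans (hφ.id_le _)) b) tendsto_const_nhds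
    filter_upwards [hlim b] with a ha
    exact ((ha.comp (Filter.tendsto_add_atTop_nat N)).const_sub _).abs
  have hpb : ∀ b, Measurable (p b) := fun b => hpm.comp measurable_prodMk_left
  have hpi : ∀ b, Integrable (p b) M.refA := fun b => by
    obtain ⟨N, hN⟩ := hL1 1 one_pos
    have h := (hN N le_rfl b).1
    have h' : Integrable (fun a => (σ N).density b a - p b a) M.refA :=
      (integrable_norm_iff
        (((σ N).measurable_density_right b).sub (hpb b)).aestronglyMeasurable).1 h
    simpa [Pi.sub_def] using (hi N b).sub h'
  refine ⟨p, hpm, hp0, hpi, fun b => ?_, fun ε hε => ?_, φ, hφ, hlim⟩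
  · refine (eq_of_forall_dist_le fun ε hε => ?_)
    obtain ⟨N, hN⟩ := hL1 ε hε
    rw [dist_comm, ← (σ N).integral_density b, Real.dist_eq, ← integral_sub (hi N b) (hpi b)]
    exact abs_integral_le_integral_abs.trans (hN N le_rfl b).2
  · obtain ⟨N, hN⟩ := hL1 ε hε
    exact ⟨N, fun k hk b => (hN k hk b).2⟩

/-- Lower semicontinuity of the free energy along densities that converge almost everywhere. -/
lemma integrable_mul_log_and_integral_le_of_tendsto {w : Weights} (hw : w.Valid)
    {g : M.Belief → M.A → ℝ} (hg : BoundedMeasurable fun x : M.Belief × M.A => g x.1 x.2)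
    {σ : ℕ → M.Policy} {b : M.Belief} {p : M.A → ℝ} (hpi : Integrable p M.refA)
    (hp1 : ∫ a, p a ∂M.refA = 1)
    (hlim : ∀ᵐ a ∂M.refA,
      Filter.Tendsto (fun i => (σ i).density b a) Filter.atTop (nhds (p a)))
    {c : ℕ → ℝ} {v : ℝ} (hc : ∀ i, value w (σ i) g b ≤ c i)
    (hcv : Filter.Tendsto c Filter.atTop (nhds v)) :
    Integrable (fun a => p a * Real.log (p a)) M.refA ∧
      w.β * ∫ a, p a * Real.log (p a) ∂M.refA + ∫ a, p a * g b a ∂M.refA ≤ v := by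
  obtain ⟨C, hC⟩ := hg.2
  have hβ := hw.β_pos
  have hgb : Measurable (g b) := hg.1.comp measurable_prodMk_left
  have hgi : ∀ q : M.A → ℝ, Integrable q M.refA → Integrable (fun a => q a * g b a) M.refA :=
    fun q hq => hq.mul_bdd (c := C) hgb.aestronglyMeasurable (ae_of_all _ fun a => hC (b, a))
  have hσi := fun i => (σ i).integrable_density b
  have hσl := fun i => (σ i).integrable_density_mul_log b
  have heval : ∀ q : M.A → ℝ, Integrable q M.refA →
      Integrable (fun a => q a * Real.log (q a)) M.refA → ∫ a, q a ∂M.refA = 1 →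
      ∫ a, (w.β * (q a * Real.log (q a)) + q a * g b a + (C * q a + w.β)) ∂M.refA
        = w.β * ∫ a, q a * Real.log (q a) ∂M.refA + ∫ a, q a * g b a ∂M.refA
          + (C + w.β * M.refA.real Set.univ) := fun q hq hql hq1 => by
    rw [integral_add ((hql.const_mul _).fun_add (hgi q hq))
      ((hq.const_mul C).fun_add (integrable_const _)), integral_add (hql.const_mul _) (hgi q hq),
      integral_add (hq.const_mul C) (integrable_const _), integral_const_mul,
      integral_const_mul, hq1, integral_const, smul_eq_mul]
    ring
  -- Adding `C * p + β` makes the integrand nonnegative and changes the integral by a constant.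
  have hfat := integrable_and_integral_le_of_tendsto (μ := M.refA)
    (f := fun i a => w.β * ((σ i).density b a * Real.log ((σ i).density b a))
      + (σ i).density b a * g b a + (C * (σ i).density b a + w.β))
    (g := fun a => w.β * (p a * Real.log (p a)) + p a * g b a + (C * p a + w.β))
    (c := fun i => c i + (C + w.β * M.refA.real Set.univ))
    (C := v + (C + w.β * M.refA.real Set.univ))
    (fun i => (((hσl i).const_mul _).add (hgi _ (hσi i))).add
      (((hσi i).const_mul C).add (integrable_const _)))
    (fun i a => ?_) ?_ (fun i => ?_) (hcv.add_const _)
  · obtain ⟨h1, h2⟩ := hfat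
    have hrest : Integrable (fun a => p a * g b a + (C * p a + w.β)) M.refA :=
      (hgi p hpi).add ((hpi.const_mul C).add (integrable_const _))
    have hlog : Integrable (fun a => p a * Real.log (p a)) M.refA := by
      have h3 := (h1.sub hrest).const_mul w.β⁻¹
      refine h3.congr (ae_of_all _ fun a => ?_)
      simp only [Pi.sub_apply]
      field_simp
      ring
    refine ⟨hlog, ?_⟩
    rw [heval p hpi hlog hp1] at h2
    linarith
  · have h1 := (σ i).density_nonneg b a
    have h2 := mul_le_mul_of_nonneg_left (neg_one_le_mul_log h1) hβ.le
    have h3 := mul_le_mul_of_nonneg_left (abs_le.1 (hC (b, a))).1 h1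
    simp only at h3
    linarith
  · filter_upwards [hlim] with a ha
    have h1 := (Real.continuous_mul_log.tendsto (p a)).comp ha
    exact ((h1.const_mul _).add (ha.mul_const _)).add ((ha.const_mul C).add_const _)
  · rw [heval _ (hσi i) (hσl i) ((σ i).integral_density b)]
    have h := hc i
    rw [value_eq_integral_refA hg] at h
    linarith

/-- Over a convex closed class an optimal policy exists: the iterates converge, and their limit
minimizes the free energy for `H`. -/
lemma IsIterationLimit.exists_isOptimal {P : M.AgentModel} {w : Weights} {Pi : Set M.Policy}
    {π : ℕ → M.Policy} {G : ℕ → M.Belief → M.A → ℝ} {H : M.Belief → M.A → ℝ} {ρ : ℕ → ℝ}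
    (h : IsIterationLimit P w Pi π G H ρ) (hM : M.Regular) (hP : P.BoundedInfoGain)
    (hw : w.Valid) (hmem : ∀ k, π k ∈ Pi) (hPi : ConvexClass Pi) (hcl : ClosedClass Pi) :
    ∃ πopt, IsOptimal P w Pi πopt := by
  have hH := h.boundedMeasurable
  have hβ := hw.β_pos
  obtain ⟨p, hpm, hp0, hpi, hp1, hL1, φ, hφ, hlim⟩ :=
    exists_limit_density (fun k => π (k + 1)) fun ε hε => by
      obtain ⟨N, hN⟩ :=
        h.exists_integral_abs_density_sub_iterate_le hM hP hw hmem hPi hε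
      exact ⟨N, fun k hk l hl b => hN (k + 1) (by omega) (l + 1) (by omega) b⟩
  have hmin : ∀ b, ∀ π' ∈ Pi, Integrable (fun a => p b a * Real.log (p b a)) M.refA ∧
      w.β * ∫ a, p b a * Real.log (p b a) ∂M.refA + ∫ a, p b a * H b a ∂M.refA
        ≤ value w π' H b := fun b π' hπ' =>
    integrable_mul_log_and_integral_le_of_tendsto hw hH (hpi b) (hp1 b) (hlim b)
      (fun i => h.value_iterate_le hM hP hw hmem (φ i) hπ' b)
      ((h.tendsto_const_add (value w π' H b)).comp hφ.tendsto_atTop)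
  obtain ⟨C, hC⟩ := hH.2
  obtain ⟨C', hC'⟩ := (boundedMeasurable_value (w := w) (π := π 0) hH).2
  have hent : ∀ b, |∫ a, p b a * Real.log (p b a) ∂M.refA|
      ≤ max ((C' + C) / w.β) (M.refA.real Set.univ) := fun b => by
    have hHb : Measurable (H b) := hH.1.comp measurable_prodMk_left
    have hi : Integrable (fun a => p b a * H b a) M.refA :=
      (hpi b).mul_bdd (c := C) hHb.aestronglyMeasurable (ae_of_all _ fun a => hC (b, a))
    have h1 : -C ≤ ∫ a, p b a * H b a ∂M.refA := by
      have h2 := integral_mono ((hpi b).mul_const (-C)) hi fun a =>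
        mul_le_mul_of_nonneg_left (abs_le.1 (hC (b, a))).1 (hp0 b a)
      rwa [integral_mul_const, hp1, one_mul] at h2
    have h3 := (hmin b (π 0) (hmem 0)).2
    have h4 := (abs_le.1 (hC' b)).2
    have h5 : ∫ a, p b a * Real.log (p b a) ∂M.refA ≤ (C' + C) / w.β := by
      rw [le_div_iff₀ hβ]
      linarith
    have h6 : -M.refA.real Set.univ ≤ ∫ a, p b a * Real.log (p b a) ∂M.refA := by
      have h7 := integral_mono (integrable_const (-1)) (hmin b (π 0) (hmem 0)).1
        fun a => neg_one_le_mul_log (hp0 b a)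
      simpa using h7
    exact abs_le.2 ⟨by linarith [le_max_right ((C' + C) / w.β) (M.refA.real Set.univ)],
      h5.trans (le_max_left _ _)⟩
  obtain ⟨πopt, -, hdens⟩ := Policy.exists_of_density p hpm hp0 (fun b => by
    rw [← ofReal_integral_eq_lintegral_ofReal (hpi b) (ae_of_all _ (hp0 b)), hp1,
      ENNReal.ofReal_one]) (fun b => (hmin b (π 0) (hmem 0)).1) hent
  have hTV : TendstoTV (fun k => π (k + 1)) πopt := fun ε hε => by
    obtain ⟨N, hN⟩ := hL1 ε hε
    refine ⟨N, fun k hk b E hE => (abs_real_sub_real_le _ _ b hE).trans ?_⟩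
    refine le_trans (le_of_eq (integral_congr_ae ?_)) (hN k hk b)
    filter_upwards [hdens b] with a ha
    rw [ha]
  refine ⟨πopt, h.isOptimal_of_value_le hM hP hw hmem
    (hcl _ πopt (fun k => hmem (k + 1)) hTV) fun b π' hπ' => ?_⟩
  refine le_trans (le_of_eq ?_) (hmin b π' hπ').2
  rw [value_eq_integral_refA hH]
  congr 1
  · congr 1
    refine integral_congr_ae ?_
    filter_upwards [hdens b] with a ha
    rw [ha]
  · refine integral_congr_ae ?_
    filter_upwards [hdens b] with a ha
    rw [ha]

end POMDP

/-! ### Unified policy iteration -/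

theorem mainTheorem1 {dS dO dA : ℕ} (M : POMDP dS dO dA) (hM : M.Regular)
    (P : M.AgentModel) (hP : P.BoundedInfoGain)
    (w : POMDP.Weights) (hw : w.Valid)
    (Pi : Set M.Policy)
    (π : ℕ → M.Policy) (G : ℕ → M.Belief → M.A → ℝ)
    (hπ0 : π 0 ∈ Pi)
    (hG0 : Measurable fun x : M.Belief × M.A => G 0 x.1 x.2)
    (hG0_bdd : ∃ C : ℝ, ∀ b a, |G 0 b a| ≤ C)
    (hG : ∀ k, G (k + 1) = POMDP.bellman P w (π k) (G k))
    (hπ : ∀ k, POMDP.IsInfoProjection w Pi (G (k + 1)) (π (k + 1))) :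
    -- for every class: the iterates are asymptotically optimal, uniformly over the beliefs
    (∀ ε > 0, ∃ N, ∀ k ≥ N, ∀ b, ∀ π' ∈ Pi,
      POMDP.efe P w (π k) b ≤ POMDP.efe P w π' b + ε) ∧
    -- for every class: the EFE iterates converge to the EFE of any optimal policy, uniformly
    (∀ πopt, POMDP.IsOptimal P w Pi πopt →
      ∀ ε > 0, ∃ N, ∀ k ≥ N, ∀ b a, |G k b a - POMDP.actionEfe P w πopt b a| ≤ ε) ∧
    -- for a convex class: an optimal policy is unique and the policy iterates converge to it
    (POMDP.ConvexClass Pi → ∀ πopt, POMDP.IsOptimal P w Pi πopt →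
      (∀ π', POMDP.IsOptimal P w Pi π' → π' = πopt) ∧ POMDP.TendstoTV π πopt) ∧
    -- for a convex closed class: an optimal policy exists
    (POMDP.ConvexClass Pi → POMDP.ClosedClass Pi → ∃ πopt, POMDP.IsOptimal P w Pi πopt) := by
  have hmem : ∀ k, π k ∈ Pi
    | 0 => hπ0
    | k + 1 => (hπ k).1
  obtain ⟨H, ρ, h⟩ := POMDP.exists_isIterationLimit hM hP hw
    ⟨hG0, hG0_bdd.imp fun _ hC x => hC x.1 x.2⟩ hG hmem hπ
  refine ⟨fun ε hε => ?_, fun πopt hopt ε hε => ?_, fun hPi πopt hopt => ?_, fun hPi hcl =>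
    h.exists_isOptimal hM hP hw hmem hPi hcl⟩
  · obtain ⟨N, hN⟩ := h.eventually_le hε
    refine ⟨N + 1, fun k hk b π' hπ' => ?_⟩
    obtain ⟨k, rfl⟩ : ∃ j, k = j + 1 := ⟨k - 1, by omega⟩
    linarith [h.efe_le k b π' hπ', h.value_le_efe hM hP hw hπ' b, hN k (by omega)]
  · obtain ⟨N, hN⟩ := h.eventually_le hε
    refine ⟨N + 1, fun k hk b a => ?_⟩
    obtain ⟨k, rfl⟩ : ∃ j, k = j + 1 := ⟨k - 1, by omega⟩
    rw [h.actionEfe_eq hM hP hw hmem hopt]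
    exact (h.abs_iterate_sub_le k b a).trans (hN k (by omega))
  · have htv := h.tendstoTV hM hP hw hmem hPi hopt
    exact ⟨fun π' hπ' => (h.tendstoTV hM hP hw hmem hPi hπ').unique htv, htv⟩
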